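/- Fix an integer $q\ge 1$. A $q$-ONCF-coloring (respectively $q$-CNCF-coloring) of a graph $G$ is a map $c\colon V(G)\to\{1,\dots,q\}$ such that for every vertex $v$ the open neighborhood $N(v)$ (respectively the closed neighborhood $N[v]=N(v)\cup\{v\}$) contains a vertex $u$ with $c(u)\ne c(w)$ for all other vertices $w$ of that neighborhood. The problem $q$-ONCF-Coloring (respectively $q$-CNCF-Coloring) asks whether a given finite simple graph has a $q$-ONCF-coloring (respectively a $q$-CNCF-coloring). Each of the two problems can be solved by a deterministic algorithm which, given a graph $G$ with $n$ vertices together with a tree decomposition of $G$ of width $t$ with $N$ nodes, runs in time $(2q^2)^t\cdot (n+N)^{O(1)}$; this is $(2q^2)^t\cdot n^{O(1)}$ if, as usual, the decomposition has $n^{O(1)}$ nodes. Precisely: for each of the two problems there are a program and constants $C,k$, depending only on $q$, such that on every such input the program halts with the correct answer after time at most $C\,(2q^2)^t\,(n+N)^k$. Time is measured on a random access machine with logarithmic cost, graph and tree are given by adjacency matrices, and the bags by the incidence matrix of nodes and vertices. The width is the size of a largest bag minus one (read as $0$ if $n=0$). -/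

import Mathlib

namespace ConflictFree

/-! ### Conflict-free colourings -/

section Coloring

variable {V : Type*}

/-- `c` is a `q`-ONCF-coloring: every open neighbourhood `N(v)` contains a vertex `u` whose colour
differs from the colours of all other vertices of `N(v)`. -/
def IsONCFColoring (G : SimpleGraph V) {q : ℕ} (c : V → Fin q) : Prop :=
  ∀ v, ∃ u ∈ G.neighborSet v, ∀ w ∈ G.neighborSet v, w ≠ u → c u ≠ c w

/-- `c` is a `q`-CNCF-coloring: every closed neighbourhood `N[v] = {v} ∪ N(v)` contains a vertex `u`
whose colour differs from the colours of all other vertices of `N[v]`. -/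
def IsCNCFColoring (G : SimpleGraph V) {q : ℕ} (c : V → Fin q) : Prop :=
  ∀ v, ∃ u ∈ insert v (G.neighborSet v), ∀ w ∈ insert v (G.neighborSet v), w ≠ u → c u ≠ c w

/-- The question of `q`-ONCF-Coloring: is there a `q`-ONCF-coloring of `G`? -/
def ONCFColorable (q : ℕ) (G : SimpleGraph V) : Prop :=
  ∃ c : V → Fin q, IsONCFColoring G c

/-- The question of `q`-CNCF-Coloring: is there a `q`-CNCF-coloring of `G`? -/
def CNCFColorable (q : ℕ) (G : SimpleGraph V) : Prop :=
  ∃ c : V → Fin q, IsCNCFColoring G c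

end Coloring

/-! ### Tree decompositions -/

/-- A tree decomposition of `G`, whose tree has node set `ι`. -/
structure TreeDecomposition {V : Type*} (G : SimpleGraph V) (ι : Type*) where
  /-- The tree. -/
  tree : SimpleGraph ι
  isTree : tree.IsTree
  /-- The bag assigned to a node of the tree. -/
  bag : ι → Finset V
  /-- Every vertex lies in a bag. -/
  exists_mem_bag : ∀ x, ∃ u, x ∈ bag u
  /-- Every edge lies in a bag. -/
  exists_edge_bag : ∀ x y, G.Adj x y → ∃ u, x ∈ bag u ∧ y ∈ bag u
  /-- A vertex in two bags lies in all bags on the path between the two nodes. -/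
  mem_bag_of_path : ∀ (x : V) (u v : ι), x ∈ bag u → x ∈ bag v →
    ∀ p : tree.Walk u v, p.IsPath → ∀ w ∈ p.support, x ∈ bag w

/-- The width of a tree decomposition: the size of a largest bag minus one. (For the graph without
vertices this is `0`.) -/
def TreeDecomposition.width {V ι : Type*} [Fintype ι] {G : SimpleGraph V}
    (T : TreeDecomposition G ι) : ℕ :=
  (Finset.univ.sup fun u => (T.bag u).card) - 1

/-! ### Random access machines with logarithmic cost

The machine has registers (a program is a finite text, so it names only finitely many of them) and a
random access memory; both hold natural numbers. Time is measured by the logarithmic cost criterion: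
an instruction is charged for the binary lengths of all the numbers and addresses it handles, and
multiplication and division are charged for the product of the lengths of the operands. -/

/-- A state of the machine: the contents of the registers and of the memory. -/
structure State where
  reg : ℕ → ℕ
  mem : ℕ → ℕ

/-- The arithmetical operations (truncated subtraction, division with rounding down). -/
inductive Op
  | add
  | sub
  | mul
  | div

/-- The value of an arithmetical operation. -/
def Op.eval : Op → ℕ → ℕ → ℕ
  | .add, x, y => x + y
  | .sub, x, y => x - y
  | .mul, x, y => x * y
  | .div, x, y => x / y

/-- The cost of an arithmetical operation. -/
def Op.cost : Op → ℕ → ℕ → ℕ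
  | .add, x, y => 1 + Nat.size x + Nat.size y
  | .sub, x, y => 1 + Nat.size x + Nat.size y
  | .mul, x, y => (1 + Nat.size x) * (1 + Nat.size y)
  | .div, x, y => (1 + Nat.size x) * (1 + Nat.size y)

/-- The elementary instructions. -/
inductive Instr
  /-- `R[d] := k` for a constant `k` -/
  | const (d k : ℕ)
  /-- `R[d] := R[a] o R[b]` -/
  | op (o : Op) (d a b : ℕ)
  /-- `R[d] := M[R[a]]` -/
  | load (d a : ℕ)
  /-- `M[R[a]] := R[b]` -/
  | store (a b : ℕ)

/-- The effect of an instruction on the state. -/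
def Instr.run : Instr → State → State
  | .const d k, s => { s with reg := Function.update s.reg d k }
  | .op o d a b, s => { s with reg := Function.update s.reg d (o.eval (s.reg a) (s.reg b)) }
  | .load d a, s => { s with reg := Function.update s.reg d (s.mem (s.reg a)) }
  | .store a b, s => { s with mem := Function.update s.mem (s.reg a) (s.reg b) }

/-- The logarithmic cost of an instruction. -/
def Instr.cost : Instr → State → ℕ
  | .const _ k, _ => 1 + Nat.size k
  | .op o _ a b, s => o.cost (s.reg a) (s.reg b)
  | .load _ a, s => 1 + Nat.size (s.reg a) + Nat.size (s.mem (s.reg a))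
  | .store a b, s => 1 + Nat.size (s.reg a) + Nat.size (s.reg b)

/-- Programs: instructions are combined by sequencing, branching and looping. -/
inductive Prog
  | instr (i : Instr)
  | seq (p p' : Prog)
  /-- if `R[a] ≠ 0` then `p` else `p'` -/
  | ite (a : ℕ) (p p' : Prog)
  /-- while `R[a] ≠ 0` do `p` -/
  | loop (a : ℕ) (p : Prog)

/-- `Exec p s c s'`: the program `p`, started in the state `s`, halts in the state `s'`, and the
execution has cost `c`. Testing a register costs one plus the binary length of its contents. -/
inductive Exec : Prog → State → ℕ → State → Prop
  | instr (i : Instr) (s : State) : Exec (.instr i) s (i.cost s) (i.run s)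
  | seq {p p' : Prog} {s s' s'' : State} {c c' : ℕ} :
      Exec p s c s' → Exec p' s' c' s'' → Exec (.seq p p') s (c + c') s''
  | ite_of_ne {a : ℕ} {p p' : Prog} {s s' : State} {c : ℕ} :
      s.reg a ≠ 0 → Exec p s c s' → Exec (.ite a p p') s (1 + Nat.size (s.reg a) + c) s'
  | ite_of_eq {a : ℕ} {p p' : Prog} {s s' : State} {c : ℕ} :
      s.reg a = 0 → Exec p' s c s' → Exec (.ite a p p') s (1 + Nat.size (s.reg a) + c) s'
  | loop_of_eq {a : ℕ} {p : Prog} {s : State} :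
      s.reg a = 0 → Exec (.loop a p) s (1 + Nat.size (s.reg a)) s
  | loop_of_ne {a : ℕ} {p : Prog} {s s' s'' : State} {c c' : ℕ} :
      s.reg a ≠ 0 → Exec p s c s' → Exec (.loop a p) s' c' s'' →
        Exec (.loop a p) s (1 + Nat.size (s.reg a) + c + c') s''

/-- The machine is deterministic: the cost and the final state are determined by the program and the
initial state. -/
theorem Exec.unique {p : Prog} {s s₁ s₂ : State} {c₁ c₂ : ℕ}
    (h₁ : Exec p s c₁ s₁) (h₂ : Exec p s c₂ s₂) : c₁ = c₂ ∧ s₁ = s₂ := by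
  induction h₁ generalizing c₂ s₂ with
  | instr i s => cases h₂; exact ⟨rfl, rfl⟩
  | seq _ _ ih ih' =>
    cases h₂ with
    | seq g g' =>
      obtain ⟨rfl, rfl⟩ := ih g
      obtain ⟨rfl, rfl⟩ := ih' g'
      exact ⟨rfl, rfl⟩
  | ite_of_ne h _ ih =>
    cases h₂ with
    | ite_of_ne _ g => obtain ⟨rfl, rfl⟩ := ih g; exact ⟨rfl, rfl⟩
    | ite_of_eq h' _ => exact absurd h' h
  | ite_of_eq h _ ih =>
    cases h₂ with
    | ite_of_ne h' _ => exact absurd h h'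
    | ite_of_eq _ g => obtain ⟨rfl, rfl⟩ := ih g; exact ⟨rfl, rfl⟩
  | loop_of_eq h =>
    cases h₂ with
    | loop_of_eq _ => exact ⟨rfl, rfl⟩
    | loop_of_ne h' _ _ => exact absurd h h'
  | loop_of_ne h _ _ ih ih' =>
    cases h₂ with
    | loop_of_eq h' => exact absurd h' h
    | loop_of_ne _ g g' =>
      obtain ⟨rfl, rfl⟩ := ih g
      obtain ⟨rfl, rfl⟩ := ih' g'
      exact ⟨rfl, rfl⟩

/-- The initial state on the input `l`: the list `l` is stored in the memory from address `0` on, and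
everything else is zero. -/
def initState (l : List ℕ) : State where
  reg := fun _ => 0
  mem := fun i => l.getD i 0

open Classical in
/-- Started on the input `l`, the program `P` halts after time at most `b`, with the answer (`1` for
yes and `0` for no) to the question `Q` in register `0`. -/
def Prog.AnswersWithin (P : Prog) (l : List ℕ) (Q : Prop) (b : ℕ) : Prop :=
  ∃ (c : ℕ) (s : State), Exec P (initState l) c s ∧ s.reg 0 = (if Q then 1 else 0) ∧ c ≤ b

/-! ### The input -/

open Classical in
/-- The entries of the 0-1 matrix of a relation, row by row. -/
noncomputable def matrixEntries {m n : ℕ} (R : Fin m → Fin n → Prop) : List ℕ :=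
  (List.finRange m).flatMap fun i => (List.finRange n).map fun j => if R i j then 1 else 0

/-- The encoding of a graph with a tree decomposition: the number `n` of vertices, the number `N` of
nodes, the adjacency matrix of the graph, the adjacency matrix of the tree, and the incidence matrix
of nodes and vertices (whether the vertex lies in the bag of the node). -/
noncomputable def encode {n N : ℕ} (G : SimpleGraph (Fin n)) (T : TreeDecomposition G (Fin N)) :
    List ℕ :=
  [n, N] ++ matrixEntries G.Adj ++ matrixEntries T.tree.Adj ++ matrixEntries fun u x => x ∈ T.bag u

end ConflictFree

open ConflictFree

namespace ConflictFree

/-! Let each vertex `v` carry a state: a colour `c v`, a colour `d v` meant to occur exactly once in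
the neighbourhood of `v`, and a bit. That makes `2 * q ^ 2` states. For fixed `c` and `d` let `k v`
be the number of vertices of colour `d v` in the neighbourhood of `v`. A conflict-free colouring
exists iff `k v = 1` for all `v` is possible. The bit replaces the bookkeeping of a counter: with
bit 0 each vertex counted by `k v` contributes a factor `B`, with bit 1 a factor `0` and the sign is
negative. Summing over the bits gives the product of all `B ^ k v - 0 ^ k v`. This product vanishes
if some `k v = 0`, equals `B ^ n` if all `k v = 1`, and is divisible by `B ^ (n + 1)` in all other
cases. So modulo `B ^ (n + 1)` the sum over all state assignments is `B ^ n` times the number of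
good pairs `(c, d)`. This number is at most `q ^ (2 * n) < B`, hence the sum is nonzero iff a
colouring exists (`sum_ne_zero_iff`).

The summand is a product of factors for single vertices and for edges, so the sum can be computed by
eliminating the vertices one by one (`prod_factor_eq_sum`). A tree decomposition yields an order in
which the later vertices that matter for a step lie in one bag
(`TreeDecomposition.exists_elimination_vertex`). Hence a step fills a table with at most `(2 * q ^
2) ^ (t + 1)` indices. Tables of different branches are just multiplied pointwise, so joins cost
nothing extra.

On the machine, everything except the loop over the indices of a table is a fixed expression with
bounded sums and products. Such expressions compile to programs of polynomial time
(`Expr.computes_compile`, `Expr.polyBounded_time`), so only the number of indices is exponential. -/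

/-! ### A language of expressions with bounded sums and products -/

/-- Expressions over variables and a memory. The summation `sum x y a` is the sum of the values of
`a` for all values of the variable `x` below the value of the variable `y`. -/
inductive Expr
  | const (k : ℕ)
  | var (x : ℕ)
  | op (o : Op) (a b : Expr)
  | load (a : Expr)
  | ite (a b c : Expr)
  | sum (x y : ℕ) (a : Expr)
  | prod (x y : ℕ) (a : Expr)

namespace Expr

/-- The value of an expression for given contents of the memory and of the variables. -/
def eval (m : ℕ → ℕ) : Expr → (ℕ → ℕ) → ℕ
  | const k, _ => k
  | var x, v => v x
  | op o a b, v => o.eval (a.eval m v) (b.eval m v)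
  | load a, v => m (a.eval m v)
  | ite a b c, v => if a.eval m v = 0 then c.eval m v else b.eval m v
  | sum x y a, v => ∑ i ∈ Finset.range (v y), a.eval m (Function.update v x i)
  | prod x y a, v => ∏ i ∈ Finset.range (v y), a.eval m (Function.update v x i)

/-- A bound for the binary length of the value of an expression, if the values of the variables are
at most `L` and the contents of the memory have binary length at most `L`. -/
def bits (L : ℕ) : Expr → ℕ
  | const k => k
  | var _ => L
  | op _ a b => a.bits L + b.bits L + 1
  | load _ => L
  | ite _ b c => b.bits L + c.bits L
  | sum _ _ a => L + a.bits L
  | prod _ _ a => L * a.bits L + 1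

end Expr

/-- The state with contents `v` of the even and `t` of the odd registers, and contents `m` of the
memory. -/
def State.mk' (v t m : ℕ → ℕ) : State where
  reg r := if r % 2 = 0 then v (r / 2) else t (r / 2)
  mem := m

/-! ### Single instructions on states with split registers: variables in the even registers,
temporaries in the odd ones. -/

section mk'

variable (v t m : ℕ → ℕ)

@[simp] theorem State.mk'_mem : (State.mk' v t m).mem = m := rfl

@[simp] theorem State.mk'_even (x : ℕ) : (State.mk' v t m).reg (2 * x) = v x := by
  simp [State.mk']

@[simp] theorem State.mk'_odd (x : ℕ) : (State.mk' v t m).reg (2 * x + 1) = t x := by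
  have h : (2 * x + 1) / 2 = x := by omega
  simp [State.mk', h]

theorem State.mk'_update_even (x k : ℕ) :
    ({ State.mk' v t m with reg := Function.update (State.mk' v t m).reg (2 * x) k } : State) =
      State.mk' (Function.update v x k) t m := by
  simp only [State.mk', State.mk.injEq, and_true]
  funext r
  simp only [Function.update_apply]
  split_ifs <;> first | rfl | omega

theorem State.mk'_update_odd (x k : ℕ) :
    ({ State.mk' v t m with reg := Function.update (State.mk' v t m).reg (2 * x + 1) k } : State) =
      State.mk' v (Function.update t x k) m := by
  simp only [State.mk', State.mk.injEq, and_true]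
  funext r
  simp only [Function.update_apply]
  split_ifs <;> first | rfl | omega

theorem exec_const_odd (d k : ℕ) :
    Exec (.instr (.const (2 * d + 1) k)) (State.mk' v t m) (1 + Nat.size k)
      (State.mk' v (Function.update t d k) m) := by
  rw [← State.mk'_update_odd]
  exact Exec.instr (.const (2 * d + 1) k) _

theorem exec_const_even (d k : ℕ) :
    Exec (.instr (.const (2 * d) k)) (State.mk' v t m) (1 + Nat.size k)
      (State.mk' (Function.update v d k) t m) := by
  rw [← State.mk'_update_even]
  exact Exec.instr (.const (2 * d) k) _

theorem exec_op_odd (o : Op) (d a b : ℕ) :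
    Exec (.instr (.op o (2 * d + 1) (2 * a + 1) (2 * b + 1))) (State.mk' v t m)
      (o.cost (t a) (t b)) (State.mk' v (Function.update t d (o.eval (t a) (t b))) m) := by
  rw [← State.mk'_update_odd]
  simpa [Instr.cost, Instr.run] using
    Exec.instr (.op o (2 * d + 1) (2 * a + 1) (2 * b + 1)) (State.mk' v t m)

theorem exec_load_odd (d a : ℕ) :
    Exec (.instr (.load (2 * d + 1) (2 * a + 1))) (State.mk' v t m)
      (1 + Nat.size (t a) + Nat.size (m (t a)))
      (State.mk' v (Function.update t d (m (t a))) m) := by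
  rw [← State.mk'_update_odd]
  simpa [Instr.cost, Instr.run] using
    Exec.instr (.load (2 * d + 1) (2 * a + 1)) (State.mk' v t m)

theorem exec_store_odd (a b : ℕ) :
    Exec (.instr (.store (2 * a + 1) (2 * b + 1))) (State.mk' v t m)
      (1 + Nat.size (t a) + Nat.size (t b))
      (State.mk' v t (Function.update m (t a) (t b))) := by
  have h := Exec.instr (.store (2 * a + 1) (2 * b + 1)) (State.mk' v t m)
  simp only [Instr.cost, Instr.run, State.mk'_odd] at h
  exact h

/-- Copying the contents of the register `r` to the register `d ≠ r`. -/
def copy (d r : ℕ) : Prog := .seq (.instr (.const d 0)) (.instr (.op .add d d r))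

theorem exec_copy_odd_even (d x : ℕ) :
    Exec (copy (2 * d + 1) (2 * x)) (State.mk' v t m) (2 + Nat.size (v x))
      (State.mk' v (Function.update t d (v x)) m) := by
  have h := Exec.instr (.op .add (2 * d + 1) (2 * d + 1) (2 * x))
    (State.mk' v (Function.update t d 0) m)
  simp only [Instr.cost, Instr.run, State.mk'_update_odd, State.mk'_odd, State.mk'_even,
    Function.update_self, Op.eval, Op.cost, zero_add, Function.update_idem, Nat.size_zero] at h
  unfold copy
  convert Exec.seq (exec_const_odd v t m d 0) h using 1
  rw [Nat.size_zero]; omega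

theorem exec_copy_even_odd (x d : ℕ) :
    Exec (copy (2 * x) (2 * d + 1)) (State.mk' v t m) (2 + Nat.size (t d))
      (State.mk' (Function.update v x (t d)) t m) := by
  have h := Exec.instr (.op .add (2 * x) (2 * x) (2 * d + 1))
    (State.mk' (Function.update v x 0) t m)
  simp only [Instr.cost, Instr.run, State.mk'_update_even, State.mk'_odd, State.mk'_even,
    Function.update_self, Op.eval, Op.cost, zero_add, Function.update_idem, Nat.size_zero] at h
  unfold copy
  convert Exec.seq (exec_const_even v t m x 0) h using 1
  rw [Nat.size_zero]; omega

end mk'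

/-- The program `p` computes the value `a` in the odd register with number `d`, within time `T`. It
changes neither the even registers nor the odd registers with smaller numbers. -/
def Computes (d : ℕ) (p : Prog) (v m : ℕ → ℕ) (a T : ℕ) : Prop :=
  ∀ t, ∃ c t', Exec p (State.mk' v t m) c (State.mk' v t' m) ∧ (∀ j < d, t' j = t j) ∧
    t' d = a ∧ c ≤ T

/-- The compilation of a bounded sum or product. -/
def foldProg (o : Op) (z x y d : ℕ) (p : Prog) : Prog :=
  .seq (.instr (.const (2 * d + 1) z)) <|
  .seq (copy (2 * (d + 1) + 1) (2 * x)) <|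
  .seq (copy (2 * (d + 2) + 1) (2 * y)) <|
  .seq (.loop (2 * (d + 2) + 1) <|
    .seq (.instr (.const (2 * (d + 3) + 1) 1)) <|
    .seq (.instr (.op .sub (2 * (d + 2) + 1) (2 * (d + 2) + 1) (2 * (d + 3) + 1))) <|
    .seq (copy (2 * x) (2 * (d + 2) + 1)) <|
    .seq p <|
    .instr (.op o (2 * d + 1) (2 * d + 1) (2 * (d + 3) + 1))) <|
  copy (2 * x) (2 * (d + 1) + 1)

/-- The compilation of an expression to a program. -/
def Expr.compile : Expr → ℕ → Prog
  | const k, d => .instr (.const (2 * d + 1) k)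
  | var x, d => copy (2 * d + 1) (2 * x)
  | op o a b, d => .seq (a.compile d) <| .seq (b.compile (d + 1)) <|
      .instr (.op o (2 * d + 1) (2 * d + 1) (2 * (d + 1) + 1))
  | load a, d => .seq (a.compile d) (.instr (.load (2 * d + 1) (2 * d + 1)))
  | ite a b c, d => .seq (a.compile d) (.ite (2 * d + 1) (b.compile d) (c.compile d))
  | sum x y a, d => foldProg .add 0 x y d (a.compile (d + 3))
  | prod x y a, d => foldProg .mul 1 x y d (a.compile (d + 3))

/-- A bound for the time for a bounded sum or product, in terms of bounds for the number of rounds,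
for the value and its time, and for the values and the time of the body. -/
def foldTime (L B b T : ℕ) : ℕ := 9 + 3 * L + L * (7 + 3 * L + T + (1 + B) * (1 + b))

/-- A bound for the time of an expression, under the same conditions as in `Expr.bits`. -/
def Expr.time (L : ℕ) : Expr → ℕ
  | const k => 1 + k
  | var _ => 2 + L
  | op _ a b => a.time L + b.time L + (1 + a.bits L) * (1 + b.bits L)
  | load a => a.time L + (1 + a.bits L + L)
  | ite a b c => a.time L + (1 + a.bits L) + b.time L + c.time L
  | sum x y a => foldTime L ((sum x y a).bits L) (a.bits L) (a.time L)
  | prod x y a => foldTime L ((prod x y a).bits L) (a.bits L) (a.time L)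

/-! ### Correctness and cost of compiled expressions. -/

theorem Op.cost_le (o : Op) (x y : ℕ) : o.cost x y ≤ (1 + Nat.size x) * (1 + Nat.size y) := by
  cases o <;> simp only [Op.cost, le_refl] <;> nlinarith [Nat.zero_le (Nat.size x * Nat.size y)]

theorem Op.cost_le_of_lt (o : Op) {x y a b : ℕ} (hx : x < 2 ^ a) (hy : y < 2 ^ b) :
    o.cost x y ≤ (1 + a) * (1 + b) :=
  (o.cost_le x y).trans <| Nat.mul_le_mul (by have := Nat.size_le.2 hx; omega)
    (by have := Nat.size_le.2 hy; omega)

theorem Op.eval_lt (o : Op) {x y a b : ℕ} (hx : x < 2 ^ a) (hy : y < 2 ^ b) :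
    o.eval x y < 2 ^ (a + b + 1) := by
  have ha : 2 ^ a ≤ 2 ^ (a + b) := Nat.pow_le_pow_right (by norm_num) (by omega)
  have hb : 2 ^ b ≤ 2 ^ (a + b) := Nat.pow_le_pow_right (by norm_num) (by omega)
  rw [pow_succ]
  cases o <;> simp only [Op.eval]
  · omega
  · omega
  · have := Nat.mul_lt_mul'' hx hy
    rw [← pow_add] at this
    omega
  · have := Nat.div_le_self x y
    omega

theorem sum_lt_two_pow {S : Finset ℕ} {L b : ℕ} (hS : S.card ≤ L) {f : ℕ → ℕ}
    (hf : ∀ i ∈ S, f i < 2 ^ b) : ∑ i ∈ S, f i < 2 ^ (L + b) := by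
  have h1 : ∑ i ∈ S, f i ≤ S.card * 2 ^ b := by
    simpa using Finset.sum_le_card_nsmul S f (2 ^ b) fun i hi => (hf i hi).le
  have h2 : S.card < 2 ^ L := hS.trans_lt L.lt_two_pow_self
  rw [pow_add]
  exact h1.trans_lt (Nat.mul_lt_mul_of_pos_right h2 (by positivity))

theorem prod_lt_two_pow {S : Finset ℕ} {L b : ℕ} (hS : S.card ≤ L) {f : ℕ → ℕ}
    (hf : ∀ i ∈ S, f i < 2 ^ b) : ∏ i ∈ S, f i < 2 ^ (L * b + 1) := by
  have h1 : ∏ i ∈ S, f i ≤ (2 ^ b) ^ S.card := Finset.prod_le_pow_card S f _ fun i hi => (hf i hi).le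
  have h2 : (2 ^ b) ^ S.card ≤ (2 ^ b) ^ L := Nat.pow_le_pow_right (by positivity) hS
  rw [mul_comm L b, pow_succ, pow_mul]
  have : 0 < (2 ^ b) ^ L := by positivity
  omega

theorem update_le {v : ℕ → ℕ} {L x i : ℕ} (hv : ∀ x, v x ≤ L) (hi : i ≤ L) (y : ℕ) :
    Function.update v x i y ≤ L := by
  rw [Function.update_apply]; split_ifs <;> simp [*]

/-- Variables are bounded by `L`, but memory cells only by `2 ^ L`: variables also serve as the
number of terms of sums and products. This keeps binary lengths polynomial in `L`. -/
theorem Expr.eval_lt {m : ℕ → ℕ} {L : ℕ} (hm : ∀ i, m i < 2 ^ L) (e : Expr) :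
    ∀ {v : ℕ → ℕ}, (∀ x, v x ≤ L) → e.eval m v < 2 ^ e.bits L := by
  induction e with
  | const k => intro v _; exact k.lt_two_pow_self
  | var x => intro v hv; exact (hv x).trans_lt L.lt_two_pow_self
  | op o a b iha ihb => intro v hv; exact o.eval_lt (iha hv) (ihb hv)
  | load a => intro v _; exact hm _
  | ite a b c _ ihb ihc =>
    intro v hv
    simp only [eval, bits]
    split_ifs
    · exact (ihc hv).trans_le (Nat.pow_le_pow_right (by norm_num) (by omega))
    · exact (ihb hv).trans_le (Nat.pow_le_pow_right (by norm_num) (by omega))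
  | sum x y a ih =>
    intro v hv
    refine sum_lt_two_pow (by simpa using hv y) fun i hi => ih (update_le hv ?_)
    have := hv y; simp at hi; omega
  | prod x y a ih =>
    intro v hv
    refine prod_lt_two_pow (by simpa using hv y) fun i hi => ih (update_le hv ?_)
    have := hv y; simp at hi; omega

/-- The loop counts down, so when the counter is `k` the accumulator holds `r k`, the result over
the indices from `k` on. The odd registers `d`, `d + 1`, `d + 2` hold the accumulator, the saved
value of the bound variable and the counter. The body works from `d + 3` on and leaves them intact.
-/
theorem Computes.fold {o : Op} {z x y d : ℕ} {p : Prog} {v m : ℕ → ℕ} {L B b T : ℕ} (hz : z ≤ 1)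
    (hv : ∀ x, v x ≤ L) (f r : ℕ → ℕ)
    (hp : ∀ i < v y, Computes (d + 3) p (Function.update v x i) m (f i) T)
    (hz' : r (v y) = z) (hr : ∀ i < v y, o.eval (r (i + 1)) (f i) = r i)
    (hB : ∀ i, r i < 2 ^ B) (hb : ∀ i < v y, f i < 2 ^ b) :
    Computes d (foldProg o z x y d p) v m (r 0) (foldTime L B b T) := by
  -- The value `u` of the bound variable is arbitrary, since each round overwrites it. The saved
  -- copy in register `d + 1` is among the registers that stay fixed.
  have hloop : ∀ k u t, k ≤ v y → t (d + 2) = k → t d = r k → ∃ c t' u',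
      Exec (.loop (2 * (d + 2) + 1) <|
        .seq (.instr (.const (2 * (d + 3) + 1) 1)) <|
        .seq (.instr (.op .sub (2 * (d + 2) + 1) (2 * (d + 2) + 1) (2 * (d + 3) + 1))) <|
        .seq (copy (2 * x) (2 * (d + 2) + 1)) <|
        .seq p <|
        .instr (.op o (2 * d + 1) (2 * d + 1) (2 * (d + 3) + 1)))
        (State.mk' (Function.update v x u) t m) c (State.mk' (Function.update v x u') t' m) ∧
      (∀ j < d + 2, j ≠ d → t' j = t j) ∧ t' d = r 0 ∧
      c ≤ 1 + k * (7 + 3 * L + T + (1 + B) * (1 + b)) := by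
    intro k
    induction k with
    | zero =>
      intro u t _ h0 hd
      refine ⟨_, t, u, Exec.loop_of_eq (by simpa using h0), fun _ _ _ => rfl, hd, ?_⟩
      simp [h0]
    | succ k ih =>
      intro u t hk h0 hd
      have e1 := exec_const_odd (Function.update v x u) t m (d + 3) 1
      set t1 := Function.update t (d + 3) 1 with ht1
      have e2 := exec_op_odd (Function.update v x u) t1 m .sub (d + 2) (d + 2) (d + 3)
      have h2 : Op.sub.eval (t1 (d + 2)) (t1 (d + 3)) = k := by
        simp [ht1, Op.eval, h0]
      have c2 : Op.sub.cost (t1 (d + 2)) (t1 (d + 3)) ≤ 2 + L := by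
        have : Nat.size (k + 1) ≤ L :=
          Nat.size_le.2 ((hk.trans (hv y)).trans_lt L.lt_two_pow_self)
        simp [ht1, Op.cost, h0]
        omega
      rw [h2] at e2
      set t2 := Function.update t1 (d + 2) k with ht2
      have e3 := exec_copy_even_odd (Function.update v x u) t2 m x (d + 2)
      have h3 : t2 (d + 2) = k := by simp [ht2]
      rw [h3, Function.update_idem] at e3
      obtain ⟨c4, t4, e4, h4, h4', hc4⟩ := hp k hk t2
      have e5 := exec_op_odd (Function.update v x k) t4 m o d d (d + 3)
      have h5 : t4 d = r (k + 1) := by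
        rw [h4 d (by omega), ht2, ht1]; simp [hd]
      rw [h4', h5, hr k hk] at e5
      set t5 := Function.update t4 d (r k) with ht5
      have h5' : t5 (d + 2) = k := by
        simp only [ht5, Function.update_apply]
        rw [if_neg (by omega), h4 _ (by omega), h3]
      obtain ⟨c6, t6, u6, e6, h6, h6', hc6⟩ := ih k t5 (by omega) h5' (by simp [ht5])
      refine ⟨_, t6, u6, Exec.loop_of_ne (by simp [h0])
        (e1.seq (e2.seq (e3.seq (e4.seq e5)))) e6, ?_, h6', ?_⟩
      · intro j hj hjd
        rw [h6 j hj hjd, ht5, Function.update_apply, if_neg hjd, h4 j (by omega), ht2, ht1]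
        simp only [Function.update_apply]
        rw [if_neg (by omega), if_neg (by omega)]
      · have c0 : Nat.size (k + 1) ≤ L :=
          Nat.size_le.2 ((hk.trans (hv y)).trans_lt L.lt_two_pow_self)
        have c3 : Nat.size k ≤ L := (Nat.size_le_size (by omega)).trans c0
        have c5 : o.cost (r (k + 1)) (f k) ≤ (1 + B) * (1 + b) := o.cost_le_of_lt (hB _) (hb k hk)
        have c1 : Nat.size 1 = 1 := by simp
        have e7 : (k + 1) * (7 + 3 * L + T + (1 + B) * (1 + b)) =
          k * (7 + 3 * L + T + (1 + B) * (1 + b)) + (7 + 3 * L + T + (1 + B) * (1 + b)) := by ring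
        rw [e7]
        simp only [State.mk'_odd, h0]
        omega
  intro t
  have e1 := exec_const_odd v t m d z
  set t1 := Function.update t d z with ht1
  have e2 := exec_copy_odd_even v t1 m (d + 1) x
  set t2 := Function.update t1 (d + 1) (v x) with ht2
  have e3 := exec_copy_odd_even v t2 m (d + 2) y
  set t3 := Function.update t2 (d + 2) (v y) with ht3
  obtain ⟨c4, t4, u4, e4, h4, h4', hc4⟩ := hloop (v y) (v x) t3 le_rfl (by simp [ht3])
    (by rw [hz', ht3, ht2, ht1]; simp)
  rw [Function.update_eq_self] at e4
  have e5 := exec_copy_even_odd (Function.update v x u4) t4 m x (d + 1)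
  have h5 : t4 (d + 1) = v x := by
    rw [h4 _ (by omega) (by omega), ht3, ht2]; simp
  rw [h5, Function.update_idem, Function.update_eq_self] at e5
  refine ⟨_, t4, e1.seq (e2.seq (e3.seq (e4.seq e5))), ?_, h4', ?_⟩
  · intro j hj
    rw [h4 j (by omega) (by omega), ht3, ht2, ht1]
    simp only [Function.update_apply]
    rw [if_neg (by omega), if_neg (by omega), if_neg (by omega)]
  · have hs : ∀ x, Nat.size (v x) ≤ L := fun x =>
      Nat.size_le.2 ((hv x).trans_lt L.lt_two_pow_self)
    have cx := hs x
    have cy := hs y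
    have cz : Nat.size z ≤ 1 := Nat.size_le.2 (by omega)
    have := Nat.mul_le_mul_right (7 + 3 * L + T + (1 + B) * (1 + b)) (hv y)
    unfold foldTime
    omega

/-- The offset `d` acts as a stack pointer: a subexpression compiled at a larger offset cannot
destroy an intermediate result kept below. -/
theorem Expr.computes_compile {m : ℕ → ℕ} {L : ℕ} (hm : ∀ i, m i < 2 ^ L) (e : Expr) :
    ∀ {v : ℕ → ℕ} (d : ℕ), (∀ x, v x ≤ L) →
      Computes d (e.compile d) v m (e.eval m v) (e.time L) := by
  induction e with
  | const k =>
    intro v d _ t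
    refine ⟨_, _, exec_const_odd v t m d k, fun j hj => by simp [hj.ne], by simp [eval], ?_⟩
    have : Nat.size k ≤ k := Nat.size_le.2 k.lt_two_pow_self
    simp only [time]; omega
  | var x =>
    intro v d hv t
    refine ⟨_, _, exec_copy_odd_even v t m d x, fun j hj => by simp [hj.ne], by simp [eval], ?_⟩
    have : Nat.size (v x) ≤ L := Nat.size_le.2 ((hv x).trans_lt L.lt_two_pow_self)
    simp only [time]; omega
  | op o a b iha ihb =>
    intro v d hv t
    obtain ⟨c1, t1, e1, h1, h1', hc1⟩ := iha d hv t
    obtain ⟨c2, t2, e2, h2, h2', hc2⟩ := ihb (d + 1) hv t1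
    have e3 := exec_op_odd v t2 m o d d (d + 1)
    rw [h2', h2 d (by omega), h1'] at e3
    refine ⟨_, _, e1.seq (e2.seq e3), fun j hj => ?_, by simp [eval], ?_⟩
    · rw [Function.update_of_ne hj.ne, h2 j (by omega), h1 j hj]
    · have := o.cost_le_of_lt (a.eval_lt hm hv) (b.eval_lt hm hv)
      simp only [time]; omega
  | load a ih =>
    intro v d hv t
    obtain ⟨c1, t1, e1, h1, h1', hc1⟩ := ih d hv t
    have e2 := exec_load_odd v t1 m d d
    rw [h1'] at e2
    refine ⟨_, _, e1.seq e2, fun j hj => ?_, by simp [eval], ?_⟩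
    · rw [Function.update_of_ne hj.ne, h1 j hj]
    · have h1 := Nat.size_le.2 (a.eval_lt hm hv)
      have h2 := Nat.size_le.2 (hm (a.eval m v))
      simp only [time]; omega
  | ite a b c iha ihb ihc =>
    intro v d hv t
    obtain ⟨c1, t1, e1, h1, h1', hc1⟩ := iha d hv t
    have ha := Nat.size_le.2 (a.eval_lt hm hv)
    by_cases h0 : a.eval m v = 0
    · obtain ⟨c2, t2, e2, h2, h2', hc2⟩ := ihc d hv t1
      refine ⟨_, _, e1.seq (.ite_of_eq (by simp [h1', h0]) e2),
        fun j hj => (h2 j hj).trans (h1 j hj), by simp [eval, h0, h2'], ?_⟩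
      simp only [time, State.mk'_odd, h1']; omega
    · obtain ⟨c2, t2, e2, h2, h2', hc2⟩ := ihb d hv t1
      refine ⟨_, _, e1.seq (.ite_of_ne (by simp [h1', h0]) e2),
        fun j hj => (h2 j hj).trans (h1 j hj), by simp [eval, h0, h2'], ?_⟩
      simp only [time, State.mk'_odd, h1']; omega
  | sum x y a ih =>
    intro v d hv
    have hle : ∀ i < v y, ∀ z, Function.update v x i z ≤ L := fun i hi =>
      update_le hv (hi.le.trans (hv y))
    have key := Computes.fold (o := .add) (B := (sum x y a).bits L) (b := a.bits L) (z := 0)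
      (by norm_num) hv
      (fun i => a.eval m (Function.update v x i))
      (fun k => ∑ i ∈ Finset.Ico k (v y), a.eval m (Function.update v x i))
      (fun i hi => ih (d + 3) (hle i hi)) (by simp)
      (fun i hi => by rw [Finset.sum_eq_sum_Ico_succ_bot hi]; simp only [Op.eval]; omega)
      (fun k => sum_lt_two_pow (by have := hv y; simp; omega) fun i hi =>
        a.eval_lt hm (hle i (Finset.mem_Ico.1 hi).2))
      (fun i hi => a.eval_lt hm (hle i hi))
    rw [← Finset.range_eq_Ico] at key
    exact key
  | prod x y a ih =>
    intro v d hv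
    have hle : ∀ i < v y, ∀ z, Function.update v x i z ≤ L := fun i hi =>
      update_le hv (hi.le.trans (hv y))
    have key := Computes.fold (o := .mul) (B := (prod x y a).bits L) (b := a.bits L) (z := 1)
      (by norm_num) hv
      (fun i => a.eval m (Function.update v x i))
      (fun k => ∏ i ∈ Finset.Ico k (v y), a.eval m (Function.update v x i))
      (fun i hi => ih (d + 3) (hle i hi)) (by simp)
      (fun i hi => by
        rw [Finset.prod_eq_prod_Ico_succ_bot hi]; simp only [Op.eval]; rw [mul_comm])
      (fun k => prod_lt_two_pow (by have := hv y; simp; omega) fun i hi =>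
        a.eval_lt hm (hle i (Finset.mem_Ico.1 hi).2))
      (fun i hi => a.eval_lt hm (hle i hi))
    rw [← Finset.range_eq_Ico] at key
    exact key

/-! ### Polynomial bounds -/

/-- The function is bounded by a polynomial. -/
def PolyBounded (f : ℕ → ℕ) : Prop := ∃ C k, ∀ L, f L ≤ C * (L + 1) ^ k

namespace PolyBounded

variable {f g : ℕ → ℕ}

theorem const (c : ℕ) : PolyBounded fun _ => c := ⟨c, 0, by simp⟩

theorem id : PolyBounded fun L => L := ⟨1, 1, fun L => by simp⟩

theorem add (hf : PolyBounded f) (hg : PolyBounded g) : PolyBounded fun L => f L + g L := by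
  obtain ⟨C, k, h⟩ := hf
  obtain ⟨C', k', h'⟩ := hg
  refine ⟨C + C', k + k', fun L => ?_⟩
  have h1 : (L + 1) ^ k ≤ (L + 1) ^ (k + k') := Nat.pow_le_pow_right (by omega) (by omega)
  have h2 : (L + 1) ^ k' ≤ (L + 1) ^ (k + k') := Nat.pow_le_pow_right (by omega) (by omega)
  rw [add_mul]
  exact add_le_add ((h L).trans (Nat.mul_le_mul_left _ h1)) ((h' L).trans (Nat.mul_le_mul_left _ h2))

theorem mul (hf : PolyBounded f) (hg : PolyBounded g) : PolyBounded fun L => f L * g L := by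
  obtain ⟨C, k, h⟩ := hf
  obtain ⟨C', k', h'⟩ := hg
  refine ⟨C * C', k + k', fun L => (Nat.mul_le_mul (h L) (h' L)).trans_eq ?_⟩
  ring

theorem comp (hf : PolyBounded f) (hg : PolyBounded g) : PolyBounded fun L => f (g L) := by
  obtain ⟨C, k, h⟩ := hf
  obtain ⟨C', k', h'⟩ := hg
  refine ⟨C * (C' + 1) ^ k, k' * k, fun L => (h (g L)).trans ?_⟩
  have h1 : 1 ≤ (L + 1) ^ k' := Nat.one_le_pow _ _ (by omega)
  have h2 : g L + 1 ≤ (C' + 1) * (L + 1) ^ k' := by have := h' L; rw [add_mul]; omega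
  calc C * (g L + 1) ^ k ≤ C * ((C' + 1) * (L + 1) ^ k') ^ k :=
        Nat.mul_le_mul_left _ (Nat.pow_le_pow_left h2 k)
    _ = _ := by rw [mul_pow, pow_mul, mul_assoc]

end PolyBounded

theorem Expr.polyBounded_bits (e : Expr) : PolyBounded fun L => e.bits L := by
  induction e with
  | const k => exact .const k
  | var => exact .id
  | op o a b iha ihb => exact (iha.add ihb).add (.const 1)
  | load => exact .id
  | ite a b c _ ihb ihc => exact ihb.add ihc
  | sum x y a ih => exact .add .id ih
  | prod x y a ih => exact (PolyBounded.id.mul ih).add (.const 1)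

theorem PolyBounded.foldTime {B b T : ℕ → ℕ} (hB : PolyBounded B) (hb : PolyBounded b)
    (hT : PolyBounded T) : PolyBounded fun L => foldTime L (B L) (b L) (T L) :=
  ((const 9).add ((const 3).mul .id)).add
    (PolyBounded.id.mul ((((const 7).add ((const 3).mul .id)).add hT).add
      (((const 1).add hB).mul ((const 1).add hb))))

/-- The degree grows with the nesting of sums and products, which is harmless because the
expressions used below depend on `q` and the kind of neighbourhood only, never on the input. -/
theorem Expr.polyBounded_time (e : Expr) : PolyBounded fun L => e.time L := by
  induction e with
  | const k => exact .const (1 + k)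
  | var => exact .add (.const 2) .id
  | op o a b iha ihb =>
    exact (iha.add ihb).add
      (((PolyBounded.const 1).add a.polyBounded_bits).mul ((PolyBounded.const 1).add b.polyBounded_bits))
  | load a ih => exact ih.add (((PolyBounded.const 1).add a.polyBounded_bits).add .id)
  | ite a b c iha ihb ihc =>
    exact ((iha.add ((PolyBounded.const 1).add a.polyBounded_bits)).add ihb).add ihc
  | sum x y a ih => exact .foldTime (sum x y a).polyBounded_bits a.polyBounded_bits ih
  | prod x y a ih => exact .foldTime (prod x y a).polyBounded_bits a.polyBounded_bits ih

/-! ### Elimination of variables from a sum of products -/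

section Elimination

variable {R : Type*} [CommRing R]

/-- Summing out the positions one by one amounts to summing over all assignments. -/
theorem eq_sum_of_step {n Q : ℕ} {H : ℕ → (ℕ → ℕ) → R}
    (hH : ∀ i < n, ∀ s, ∑ a ∈ Finset.range Q, H i (Function.update s i a) = H (i + 1) s)
    (s : ℕ → ℕ) :
    H n s = ∑ τ : Fin n → Fin Q, H 0 fun j => if h : j < n then (τ ⟨j, h⟩ : ℕ) else s j := by
  induction n generalizing s with
  | zero => simp
  | succ n ih =>
    rw [← hH n (by omega), Finset.sum_range,
      ← (Fin.snocEquiv fun _ : Fin (n + 1) => Fin Q).sum_comp, Fintype.sum_prod_type]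
    refine Finset.sum_congr rfl fun a _ => ?_
    rw [ih (fun i hi => hH i (by omega))]
    refine Finset.sum_congr rfl fun τ _ => ?_
    congr 1
    funext j
    simp only [Fin.snocEquiv, Equiv.coe_fn_mk, Fin.snoc]
    by_cases h : j < n
    · simp [h, Nat.lt_succ_of_lt h]
    · by_cases h' : j = n
      · subst h'; simp
      · have : ¬ j < n + 1 := by omega
        simp [h, h', this]

variable (n Q : ℕ) (w : ℕ → R) (φ : ℕ → ℕ → R) (g b : ℕ → ℕ → Prop)

/-- The position `i` is the first one after `h` that is related to `h`. -/
def IsParent (h i : ℕ) : Prop := b h i ∧ ∀ k < i, h < k → ¬ b h k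

open Classical in
/-- The factor that arises from the elimination of position `i`. -/
noncomputable def factor (i : ℕ) (s : ℕ → ℕ) : R :=
  ∑ a ∈ Finset.range Q, w a * (∏ j ∈ Finset.range n, if i < j ∧ g i j then φ a (s j) else 1) *
    ∏ h : Fin i, if IsParent b h i then factor h (Function.update s i a) else 1

open Classical in
theorem factor_eq (i : ℕ) (s : ℕ → ℕ) : factor n Q w φ g b i s =
    ∑ a ∈ Finset.range Q, w a * (∏ j ∈ Finset.range n, if i < j ∧ g i j then φ a (s j) else 1) *
    ∏ h ∈ Finset.range i,
      if IsParent b h i then factor n Q w φ g b h (Function.update s i a) else 1 := by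
  rw [factor]
  refine Finset.sum_congr rfl fun a _ => ?_
  rw [Finset.prod_range (fun h =>
    if IsParent b h i then factor n Q w φ g b h (Function.update s i a) else 1)]

variable {n b g} (hg : ∀ i j, i < j → j < n → g i j → b i j)
  (hb : ∀ i j k, i < j → j < k → k < n → b i j → b i k → b j k)
include hg hb

/-- The factor of a position depends only on the later positions that are related to it. -/
theorem factor_congr (i : ℕ) (hi : i < n) {s t : ℕ → ℕ}
    (h : ∀ k, i < k → k < n → b i k → s k = t k) :
    factor n Q w φ g b i s = factor n Q w φ g b i t := by
  induction i using Nat.strong_induction_on generalizing s t with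
  | _ i ih =>
    rw [factor_eq, factor_eq]
    refine Finset.sum_congr rfl fun a _ => ?_
    congr 1
    · congr 1
      refine Finset.prod_congr rfl fun j hj => ?_
      split_ifs with hij
      · rw [h j hij.1 (Finset.mem_range.1 hj) (hg i j hij.1 (Finset.mem_range.1 hj) hij.2)]
      · rfl
    · refine Finset.prod_congr rfl fun l hl => ?_
      have hl := Finset.mem_range.1 hl
      split_ifs with hp
      · refine ih l hl (by omega) fun k hk hkn hlk => ?_
        -- A later position related to a child `l` of `i` is either `i`, which has the value `a` on
        -- both sides, or lies beyond `i` and is then related to `i` by `hb`. None lies between `l`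
        -- and `i`, since `i` is the first.
        by_cases hki : k = i
        · simp [hki]
        · have : i < k := by
            by_contra hlt
            exact hp.2 k (by omega) hk hlk
          rw [Function.update_of_ne hki, Function.update_of_ne hki]
          exact h k this hkn (hb l i k hl this hkn hp.1 hlk)
      · rfl

open Classical in
/-- The sum over all assignments of a product of weights of positions and of pairs of positions can
be computed by elimination. -/
theorem prod_factor_eq_sum (s : ℕ → ℕ) :
    (∏ h ∈ Finset.range n,
      if ∀ k < n, h < k → ¬ b h k then factor n Q w φ g b h s else 1) =
    ∑ τ : Fin n → Fin Q, (∏ j : Fin n, w (τ j)) *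
      ∏ j : Fin n, ∏ k : Fin n, if j < k ∧ g j k then φ (τ j) (τ k) else 1 := by
  -- `H i` is what remains when the positions below `i` are summed out: the weights and pair factors
  -- of the positions from `i` on, times the factors of the current roots, that is, of the
  -- eliminated positions that no position below `i` has absorbed.
  have key := eq_sum_of_step (n := n) (Q := Q) (H := fun i s =>
    (∏ j ∈ Finset.Ico i n, w (s j)) *
    (∏ j ∈ Finset.Ico i n, ∏ k ∈ Finset.range n, if j < k ∧ g j k then φ (s j) (s k) else 1) *
    ∏ h ∈ Finset.range i, if ∀ k < i, h < k → ¬ b h k then factor n Q w φ g b h s else 1)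
    (fun i hi s => by
      rw [Finset.prod_range_succ, if_pos (fun k hk hk' => by omega),
        factor_eq n Q w φ g b i s, ← mul_assoc, Finset.mul_sum]
      refine Finset.sum_congr rfl fun a _ => ?_
      rw [Finset.prod_eq_prod_Ico_succ_bot hi, Finset.prod_eq_prod_Ico_succ_bot hi]
      have e1 : ∏ j ∈ Finset.Ico (i + 1) n, w (Function.update s i a j) =
          ∏ j ∈ Finset.Ico (i + 1) n, w (s j) :=
        Finset.prod_congr rfl fun j hj => by
          rw [Function.update_of_ne (by have := Finset.mem_Ico.1 hj; omega)]
      have e2 : (∏ j ∈ Finset.Ico (i + 1) n, ∏ k ∈ Finset.range n, if j < k ∧ g j k then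
          φ (Function.update s i a j) (Function.update s i a k) else 1) =
          ∏ j ∈ Finset.Ico (i + 1) n, ∏ k ∈ Finset.range n, if j < k ∧ g j k then
          φ (s j) (s k) else 1 :=
        Finset.prod_congr rfl fun j hj => Finset.prod_congr rfl fun k _ => by
          have := Finset.mem_Ico.1 hj
          split_ifs with h
          · rw [Function.update_of_ne (by omega), Function.update_of_ne (by omega)]
          · rfl
      have e3 : (∏ k ∈ Finset.range n, if i < k ∧ g i k then
          φ (Function.update s i a i) (Function.update s i a k) else 1) =
          ∏ k ∈ Finset.range n, if i < k ∧ g i k then φ a (s k) else 1 :=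
        Finset.prod_congr rfl fun k _ => by
          split_ifs with h
          · rw [Function.update_self, Function.update_of_ne (by omega)]
          · rfl
      -- Position `i` absorbs exactly the roots whose parent it is. The other roots do not depend on
      -- the value at `i` and can be taken out of the sum; `i` itself becomes a root.
      have e4 : (∏ h ∈ Finset.range i, if ∀ k < i, h < k → ¬ b h k then
          factor n Q w φ g b h (Function.update s i a) else 1) =
          (∏ h ∈ Finset.range i, if IsParent b h i then
            factor n Q w φ g b h (Function.update s i a) else 1) *
          ∏ h ∈ Finset.range i, if ∀ k < i + 1, h < k → ¬ b h k then
            factor n Q w φ g b h s else 1 := by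
        rw [← Finset.prod_mul_distrib]
        refine Finset.prod_congr rfl fun h hh => ?_
        have hh := Finset.mem_range.1 hh
        by_cases h1 : ∀ k < i, h < k → ¬ b h k
        · by_cases h2 : b h i
          · rw [if_pos h1, if_pos ⟨h2, h1⟩, if_neg (fun h3 => h3 i (by omega) hh h2), mul_one]
          · have h3 : ∀ k < i + 1, h < k → ¬ b h k := fun k hk hhk => by
              rcases Nat.lt_succ_iff_lt_or_eq.1 hk with hk | rfl
              · exact h1 k hk hhk
              · exact h2
            rw [if_pos h1, if_neg (fun h4 => h2 h4.1), if_pos h3, one_mul]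
            refine factor_congr Q w φ hg hb h (by omega) fun k hk hkn hbk => ?_
            rw [Function.update_of_ne]
            rintro rfl
            exact h2 hbk
        · rw [if_neg h1, if_neg (fun h4 => h1 h4.2),
            if_neg (fun h4 => h1 fun k hk => h4 k (by omega)), mul_one]
      rw [e1, e2, e3, e4, Function.update_self]
      ring) s
  simp only [Finset.Ico_self, Finset.prod_empty, one_mul, Finset.range_zero, mul_one] at key
  rw [key]
  refine Finset.sum_congr rfl fun τ _ => ?_
  rw [← Finset.range_eq_Ico, Finset.prod_range, Finset.prod_range]
  congr 1
  · exact Finset.prod_congr rfl fun j _ => by simp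
  · refine Finset.prod_congr rfl fun j _ => ?_
    rw [Finset.prod_range]
    exact Finset.prod_congr rfl fun k _ => by simp

end Elimination

/-! ### Counting conflict-free colourings

A state of a vertex is a number below `2 * q ^ 2` that encodes a colour, the colour that shall be
unique in the neighbourhood, and a bit. -/

/-- The digits of the states of the vertices. -/
def stateEquiv (q : ℕ) (hq : 0 < q) : Fin (2 * q ^ 2) ≃ (Fin q × Fin q) × Fin 2 where
  toFun a := ((⟨a % q, Nat.mod_lt _ hq⟩, ⟨a / q % q, Nat.mod_lt _ hq⟩),
    ⟨a / q ^ 2, Nat.div_lt_of_lt_mul (a.2.trans_eq (mul_comm _ _))⟩)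
  invFun x := ⟨x.1.1 + q * (x.1.2 + q * x.2), by
    have h1 := x.1.1.2
    have h2 := x.1.2.2
    have h3 := x.2.2
    have : (x.1.2 + q * x.2 : ℕ) + 1 ≤ q * 2 := by nlinarith
    nlinarith⟩
  left_inv a := by
    ext
    have h : (a : ℕ) / q ^ 2 = a / q / q := by
      rw [Nat.div_div_eq_div_mul, ← pow_two]
    simp only [h, Nat.mod_add_div]
  right_inv x := by
    obtain ⟨⟨c, d⟩, e⟩ := x
    simp only [Prod.mk.injEq]
    refine ⟨⟨?_, ?_⟩, ?_⟩ <;> ext <;> simp only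
    · simp [Nat.mod_eq_of_lt c.2]
    · rw [Nat.add_mul_div_left _ _ hq, Nat.div_eq_of_lt c.2]
      simp [Nat.mod_eq_of_lt d.2]
    · rw [pow_two, ← Nat.div_div_eq_div_mul, Nat.add_mul_div_left _ _ hq, Nat.div_eq_of_lt c.2,
        zero_add, Nat.add_mul_div_left _ _ hq, Nat.div_eq_of_lt d.2, zero_add]

/-- The contribution of a vertex with state `a` to a vertex with state `b` that has it in its
neighbourhood. -/
def effect {R : Type*} [CommSemiring R] (q : ℕ) (B : R) (a b : ℕ) : R :=
  if a % q = b / q % q then (if b / q ^ 2 = 0 then B else 0) else 1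

/-- The sign of a state. -/
def sign {R : Type*} [CommRing R] (q : ℕ) (a : ℕ) : R := if a / q ^ 2 = 0 then 1 else -1

section Counting

variable {V : Type*} [Fintype V] [DecidableEq V]

/-- The bit of `v` occurs only in the factors at `v`, so for fixed colours the sum over all bits
splits into a product over `v`. Bit 0 gives `B ^ k` and bit 1 gives `-0 ^ k`, where `k` is the
number of matches; here `0 ^ 0 = 1`. -/
theorem sum_sign_mul_effect {R : Type*} [CommRing R] {q : ℕ} (hq : 0 < q) (nb : V → Finset V)
    (B : R) :
    ∑ σ : V → Fin (2 * q ^ 2), ∏ v, (sign q (σ v) * ∏ u ∈ nb v, effect q B (σ u) (σ v)) =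
      ∑ c : V → Fin q, ∑ d : V → Fin q, ∏ v,
        (B ^ {u ∈ nb v | c u = d v}.card - 0 ^ {u ∈ nb v | c u = d v}.card) := by
  classical
  let e : (V → Fin (2 * q ^ 2)) ≃ ((V → Fin q) × (V → Fin q)) × (V → Fin 2) :=
    ((Equiv.refl V).arrowCongr (stateEquiv q hq)).trans <|
      (Equiv.arrowProdEquivProdArrow V (fun _ => Fin q × Fin q) (fun _ => Fin 2)).trans <|
      (Equiv.arrowProdEquivProdArrow V (fun _ => Fin q) (fun _ => Fin q)).prodCongr (Equiv.refl _)
  rw [Fintype.sum_equiv e _ (fun x => ∏ v, ((if x.2 v = 0 then 1 else -1) * ∏ u ∈ nb v,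
      if x.1.1 u = x.1.2 v then (if x.2 v = 0 then B else 0) else 1)) fun σ => by
      simp [e, stateEquiv, effect, sign, Fin.ext_iff],
    Fintype.sum_prod_type, Fintype.sum_prod_type]
  refine Finset.sum_congr rfl fun c _ => Finset.sum_congr rfl fun d _ => ?_
  have key := (Finset.prod_univ_sum (fun _ : V => (Finset.univ : Finset (Fin 2)))
    fun v b => (if b = 0 then 1 else -1) * ∏ u ∈ nb v,
      if c u = d v then (if b = 0 then B else 0) else 1).symm
  rw [Fintype.piFinset_univ] at key
  rw [key]
  refine Finset.prod_congr rfl fun v _ => ?_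
  simp [Fin.sum_univ_two, Finset.prod_ite, sub_eq_add_neg]

/-- If some count is zero, a factor is `1 - 1`. If all counts are positive and one exceeds one, they
add up to more than the number of vertices, so the power of `B` vanishes modulo `B ^ (card V + 1)`.
-/
theorem sum_eq_card_mul {q : ℕ} (nb : V → Finset V) (B : ℕ) :
    ∑ c : V → Fin q, ∑ d : V → Fin q, ∏ v,
        ((B : ZMod (B ^ (Fintype.card V + 1))) ^ {u ∈ nb v | c u = d v}.card -
          0 ^ {u ∈ nb v | c u = d v}.card) =
      (Fintype.card {x : (V → Fin q) × (V → Fin q) //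
        ∀ v, {u ∈ nb v | x.1 u = x.2 v}.card = 1} * B ^ Fintype.card V : ℕ) := by
  classical
  rw [← Fintype.sum_prod_type', Fintype.card_subtype, Finset.card_filter, Finset.sum_mul,
    Nat.cast_sum]
  refine Finset.sum_congr rfl fun x _ => ?_
  split_ifs with h
  · simp [h]
  · push_cast
    rw [zero_mul]
    by_cases h0 : ∃ v, {u ∈ nb v | x.1 u = x.2 v}.card = 0
    · obtain ⟨v, hv⟩ := h0
      exact Finset.prod_eq_zero (Finset.mem_univ v) (by rw [hv]; simp)
    · push Not at h0 h
      rw [Finset.prod_congr rfl fun v _ => by rw [zero_pow (h0 v), sub_zero],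
        Finset.prod_pow_eq_pow_sum]
      have hlt : Fintype.card V < ∑ v, {u ∈ nb v | x.1 u = x.2 v}.card := by
        rw [← Finset.card_univ, Finset.card_eq_sum_ones]
        obtain ⟨v, hv⟩ := h
        refine Finset.sum_lt_sum (fun v _ => Nat.one_le_iff_ne_zero.2 (h0 v))
          ⟨v, Finset.mem_univ v, ?_⟩
        have := h0 v
        omega
      obtain ⟨k, hk⟩ := Nat.exists_eq_add_of_lt hlt
      rw [hk, add_right_comm, pow_add _ (Fintype.card V + 1) k]
      have : ((B ^ (Fintype.card V + 1) : ℕ) : ZMod (B ^ (Fintype.card V + 1))) = 0 :=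
        ZMod.natCast_self _
      rw [Nat.cast_pow] at this
      rw [this, zero_mul]

/-- After cancelling `B ^ n`, the sum is zero iff `B` divides the number of good pairs, and that
number is too small to be a positive multiple of `B`. In a good pair, the second component names the
unique colours. -/
theorem sum_ne_zero_iff {q n : ℕ} (hq : 0 < q) (hn : Fintype.card V = n) (nb : V → Finset V)
    {B : ℕ} (hB : (q ^ 2) ^ n < B) :
    ∑ σ : V → Fin (2 * q ^ 2), ∏ v, (sign q (σ v) * ∏ u ∈ nb v,
      effect q (B : ZMod (B ^ (n + 1))) (σ u) (σ v)) ≠ 0 ↔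
    ∃ c : V → Fin q, ∀ v, ∃ u ∈ nb v, ∀ w ∈ nb v, w ≠ u → c u ≠ c w := by
  classical
  subst hn
  have hB0 : 0 < B := by omega
  rw [sum_sign_mul_effect hq, sum_eq_card_mul, Ne, ZMod.natCast_eq_zero_iff, pow_succ',
    Nat.mul_dvd_mul_iff_right (by positivity)]
  have hlt : Fintype.card {x : (V → Fin q) × (V → Fin q) //
      ∀ v, {u ∈ nb v | x.1 u = x.2 v}.card = 1} < B := by
    refine (Fintype.card_subtype_le _).trans_lt ?_
    rw [← pow_mul, mul_comm, pow_mul] at hB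
    simpa [← pow_two] using hB
  have hdvd : ¬ B ∣ Fintype.card {x : (V → Fin q) × (V → Fin q) //
      ∀ v, {u ∈ nb v | x.1 u = x.2 v}.card = 1} ↔ Nonempty {x : (V → Fin q) × (V → Fin q) //
      ∀ v, {u ∈ nb v | x.1 u = x.2 v}.card = 1} := by
    rw [← Fintype.card_pos_iff]
    constructor
    · intro h
      by_contra h0
      exact h (by rw [Nat.eq_zero_of_not_pos h0]; exact dvd_zero _)
    · exact fun h hd => absurd (Nat.le_of_dvd h hd) (by omega)
  rw [hdvd, nonempty_subtype]
  constructor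
  · rintro ⟨⟨c, d⟩, h⟩
    refine ⟨c, fun v => ?_⟩
    obtain ⟨u, hu⟩ := Finset.card_eq_one.1 (h v)
    have hu' : u ∈ {u ∈ nb v | c u = d v} := by rw [hu]; simp
    rw [Finset.mem_filter] at hu'
    refine ⟨u, hu'.1, fun w hw hwu hc => hwu ?_⟩
    have : w ∈ {u ∈ nb v | c u = d v} := Finset.mem_filter.2 ⟨hw, hc ▸ hu'.2⟩
    rwa [hu, Finset.mem_singleton] at this
  · rintro ⟨c, h⟩
    choose u hu hu' using h
    refine ⟨(c, fun v => c (u v)), fun v => Finset.card_eq_one.2 ⟨u v, ?_⟩⟩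
    ext w
    simp only [Finset.mem_filter, Finset.mem_singleton]
    constructor
    · rintro ⟨hw, hc⟩
      by_contra hne
      exact hu' v w hw hne hc.symm
    · rintro rfl
      exact ⟨hu v, rfl⟩

/-- The product over ordered pairs of a symmetric relation, sorted by the smaller element. -/
theorem prod_pairs {R : Type*} [CommRing R] {n : ℕ} (g : Fin n → Fin n → Prop)
    [DecidableRel g] (hg : ∀ i j, g i j → g j i) (hi : ∀ i, ¬ g i i) (f : Fin n → Fin n → R) :
    ∏ j, ∏ k, (if j < k ∧ g j k then f j k * f k j else 1) =
      ∏ v, ∏ u ∈ {u | g v u}, f u v := by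
  have e1 : ∀ j k, (if j < k ∧ g j k then f j k * f k j else 1) =
      (if j < k ∧ g j k then f j k else 1) * (if j < k ∧ g j k then f k j else 1) := by
    intro j k; split_ifs <;> simp
  simp only [e1, Finset.prod_mul_distrib]
  -- Exchanging the order of one double product makes `v` the second argument of `f` in both; one
  -- then covers the `u` below `v`, the other those above.
  rw [Finset.prod_comm, ← Finset.prod_mul_distrib]
  refine Finset.prod_congr rfl fun v _ => ?_
  rw [← Finset.prod_mul_distrib, Finset.prod_filter]
  refine Finset.prod_congr rfl fun u _ => ?_
  by_cases h : g v u
  · have h' := hg _ _ h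
    have hne : u ≠ v := by rintro rfl; exact hi _ h
    rcases lt_or_gt_of_ne hne with hlt | hlt
    · simp [h, h', hlt, hlt.not_gt]
    · simp [h, h', hlt, hlt.not_gt]
  · have h' : ¬ g u v := fun h' => h (hg _ _ h')
    simp [h, h']

end Counting

/-! ### Elimination orders from tree decompositions -/

theorem isPath_append {ι : Type*} {t : SimpleGraph ι} {u v w : ι} {p : t.Walk u v} {p' : t.Walk v w}
    (hp : p.IsPath) (hp' : p'.IsPath) (h : ∀ z ∈ p.support, z ∈ p'.support → z = v) :
    (p.append p').IsPath := by
  rw [SimpleGraph.Walk.isPath_def] at hp hp' ⊢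
  rw [SimpleGraph.Walk.support_append, List.nodup_append]
  rw [← SimpleGraph.Walk.cons_tail_support, List.nodup_cons] at hp'
  refine ⟨hp, hp'.2, fun a ha b hb hab => ?_⟩
  subst hab
  have := h a ha (List.mem_of_mem_tail hb)
  subst this
  exact hp'.1 hb

theorem dist_lt_of_mem_support {ι : Type*} {t : SimpleGraph ι} {r u z : ι} {p : t.Walk r u}
    (hp : p.length = t.dist r u) (hz : z ∈ p.support) (hzu : z ≠ u) : t.dist r z < t.dist r u := by
  classical
  rw [← hp]
  exact (SimpleGraph.dist_le _).trans_lt (p.length_takeUntil_lt_length hz hzu)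

/-- Every nonempty set `A` of vertices contains a vertex `v` such that some bag contains every
vertex of `A` that has a bag in common with `v`. -/
theorem TreeDecomposition.exists_elimination_vertex {V ι : Type*} {G : SimpleGraph V}
    (T : TreeDecomposition G ι) {A : Finset V} (hA : A.Nonempty) :
    ∃ v ∈ A, ∃ u, ∀ w, v ∈ T.bag w → ∀ x ∈ A, x ∈ T.bag w → x ∈ T.bag u := by
  classical
  obtain ⟨r⟩ := T.isTree.connected.nonempty
  -- The tree is rooted at `r`, and `top x` is a node closest to `r` whose bag contains `x`. The
  -- vertex to be eliminated is one with the deepest `top`.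
  have htop : ∀ x, ∃ u, x ∈ T.bag u ∧ ∀ w, x ∈ T.bag w → T.tree.dist r u ≤ T.tree.dist r w := by
    intro x
    obtain ⟨u, hu, hmin⟩ := (measure (T.tree.dist r)).wf.has_min {u | x ∈ T.bag u}
      (T.exists_mem_bag x)
    exact ⟨u, hu, fun w hw => not_lt.1 (hmin w hw)⟩
  choose top htop hmin using htop
  -- A path from `r` to a node of `x` runs through `top x`: beyond it all bags contain `x`, and
  -- before it the nodes are closer to `r` than any such node.
  have hpath : ∀ x w, x ∈ T.bag w → ∃ (p : T.tree.Walk r (top x)) (p' : T.tree.Walk (top x) w),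
      p.length = T.tree.dist r (top x) ∧ p'.IsPath ∧ (p.append p').IsPath := by
    intro x w hw
    obtain ⟨p, hp, hlen⟩ := T.isTree.connected.exists_path_of_dist r (top x)
    obtain ⟨p', hp', -⟩ := T.isTree.connected.exists_path_of_dist (top x) w
    refine ⟨p, p', hlen, hp', isPath_append hp hp' fun z hz hz' => ?_⟩
    by_contra hne
    have h1 := dist_lt_of_mem_support hlen hz hne
    have h2 := hmin x z (T.mem_bag_of_path x _ _ (htop x) hw p' hp' z hz')
    omega
  obtain ⟨v, hvA, hv⟩ := A.exists_max_image (fun v => T.tree.dist r (top v)) hA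
  refine ⟨v, hvA, top v, fun w hvw x hx hxw => ?_⟩
  obtain ⟨p, p', -, -, hp⟩ := hpath v w hvw
  obtain ⟨s, s', hs, hs', hss⟩ := hpath x w hxw
  -- As `v` and `x` share the bag of `w`, both tops lie on the unique path from `r` to `w`. Either
  -- `top v` comes no later than `top x`, and the two coincide by the choice of `v`, or it lies on
  -- the stretch whose bags contain `x`.
  have heq : p.append p' = s.append s' :=
    (T.isTree.existsUnique_path r w).unique hp hss
  have hmem : top v ∈ (s.append s').support := by
    rw [← heq, SimpleGraph.Walk.mem_support_append_iff]
    exact Or.inl p.end_mem_support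
  rw [SimpleGraph.Walk.mem_support_append_iff] at hmem
  rcases hmem with h | h
  · by_cases hne : top v = top x
    · rw [hne]; exact htop x
    · have h1 := dist_lt_of_mem_support hs h hne
      have h2 := hv x hx
      omega
  · exact T.mem_bag_of_path x _ _ (htop x) hxw s' hs' _ h

/-! ### Programs that change the variables and the memory -/

/-- The program `p` changes the variables and the memory from `v`, `m` to `v'`, `m'`, within time
`T` and without changing the odd registers with numbers below `d`. -/
def Runs (d : ℕ) (p : Prog) (v m v' m' : ℕ → ℕ) (T : ℕ) : Prop :=
  ∀ t, ∃ c t', Exec p (State.mk' v t m) c (State.mk' v' t' m') ∧ (∀ j < d, t' j = t j) ∧ c ≤ T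

theorem Runs.seq {d : ℕ} {p p' : Prog} {v m v' m' v'' m'' : ℕ → ℕ} {T T' : ℕ}
    (h : Runs d p v m v' m' T) (h' : Runs d p' v' m' v'' m'' T') :
    Runs d (.seq p p') v m v'' m'' (T + T') := by
  intro t
  obtain ⟨c, t1, e, h1, hc⟩ := h t
  obtain ⟨c', t2, e', h2, hc'⟩ := h' t1
  exact ⟨_, t2, e.seq e', fun j hj => (h2 j hj).trans (h1 j hj), add_le_add hc hc'⟩

/-- The program for `M[a] := e`. -/
def storeProg (a e : Expr) (d : ℕ) : Prog :=
  .seq (a.compile d) <| .seq (e.compile (d + 1)) (.instr (.store (2 * d + 1) (2 * (d + 1) + 1)))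

/-- A bound for the time of `storeProg`. -/
def storeTime (a e : Expr) (L : ℕ) : ℕ := a.time L + e.time L + (1 + a.bits L + e.bits L)

theorem runs_storeProg {m v : ℕ → ℕ} {L : ℕ} (hm : ∀ i, m i < 2 ^ L) (hv : ∀ x, v x ≤ L)
    (a e : Expr) (d : ℕ) :
    Runs d (storeProg a e d) v m v (Function.update m (a.eval m v) (e.eval m v))
      (storeTime a e L) := by
  intro t
  obtain ⟨c1, t1, e1, h1, h1', hc1⟩ := a.computes_compile hm d hv t
  obtain ⟨c2, t2, e2, h2, h2', hc2⟩ := e.computes_compile hm (d + 1) hv t1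
  have e3 := exec_store_odd v t2 m d (d + 1)
  rw [h2', h2 d (by omega), h1'] at e3
  refine ⟨_, t2, e1.seq (e2.seq e3), fun j hj => (h2 j (by omega)).trans (h1 j hj), ?_⟩
  have h3 := Nat.size_le.2 (a.eval_lt hm hv)
  have h4 := Nat.size_le.2 (e.eval_lt hm hv)
  simp only [storeTime]; omega

/-- The program for `x := e`. -/
def assignProg (x : ℕ) (e : Expr) (d : ℕ) : Prog :=
  .seq (e.compile d) (copy (2 * x) (2 * d + 1))

/-- A bound for the time of `assignProg`. -/
def assignTime (e : Expr) (L : ℕ) : ℕ := e.time L + (2 + e.bits L)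

theorem runs_assignProg {m v : ℕ → ℕ} {L : ℕ} (hm : ∀ i, m i < 2 ^ L) (hv : ∀ x, v x ≤ L)
    (x : ℕ) (e : Expr) (d : ℕ) :
    Runs d (assignProg x e d) v m (Function.update v x (e.eval m v)) m (assignTime e L) := by
  intro t
  obtain ⟨c1, t1, e1, h1, h1', hc1⟩ := e.computes_compile hm d hv t
  have e2 := exec_copy_even_odd v t1 m x d
  rw [h1'] at e2
  refine ⟨_, t1, e1.seq e2, h1, ?_⟩
  have h4 := Nat.size_le.2 (e.eval_lt hm hv)
  simp only [assignTime]; omega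

/-- The program that runs `p` for all values of the variable `x` below the value of the variable
`y`, in increasing order. -/
def forProg (x y d : ℕ) (p : Prog) : Prog :=
  .seq (copy (2 * d + 1) (2 * y)) <|
  .seq (.instr (.const (2 * (d + 1) + 1) 0)) <|
  .seq (.loop (2 * d + 1) <|
    .seq (copy (2 * x) (2 * (d + 1) + 1)) <|
    .seq p <|
    .seq (.instr (.const (2 * (d + 2) + 1) 1)) <|
    .seq (.instr (.op .add (2 * (d + 1) + 1) (2 * (d + 1) + 1) (2 * (d + 2) + 1))) <|
    .instr (.op .sub (2 * d + 1) (2 * d + 1) (2 * (d + 2) + 1))) <|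
  .instr (.const (2 * x) 0)

/-- A bound for the time of `forProg`. -/
def forTime (L T : ℕ) : ℕ := 5 + L + L * (9 + 4 * L + T)

/-- This loop modifies the memory, so an invariant `I` describes it. Register `d` counts the
remaining rounds and `d + 1` holds the index; the loop variable ends as 0 instead of being restored.
-/
theorem runs_forProg {v : ℕ → ℕ} {x y d L T : ℕ} {p : Prog} (hv : ∀ x, v x ≤ L)
    (I : ℕ → (ℕ → ℕ) → Prop)
    (hp : ∀ k < v y, ∀ m, I k m → ∃ m', I (k + 1) m' ∧
      Runs (d + 2) p (Function.update v x k) m (Function.update v x k) m' T)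
    {m : ℕ → ℕ} (hm : I 0 m) :
    ∃ m', I (v y) m' ∧ Runs d (forProg x y d p) v m (Function.update v x 0) m' (forTime L T) := by
  have hloop : ∀ k i m, k + i = v y → I i m → ∃ m', I (v y) m' ∧ ∀ t u, t d = k → t (d + 1) = i →
      ∃ c t' u', Exec (.loop (2 * d + 1) <|
        .seq (copy (2 * x) (2 * (d + 1) + 1)) <|
        .seq p <|
        .seq (.instr (.const (2 * (d + 2) + 1) 1)) <|
        .seq (.instr (.op .add (2 * (d + 1) + 1) (2 * (d + 1) + 1) (2 * (d + 2) + 1))) <|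
        .instr (.op .sub (2 * d + 1) (2 * d + 1) (2 * (d + 2) + 1)))
        (State.mk' (Function.update v x u) t m) c (State.mk' (Function.update v x u') t' m') ∧
      (∀ j < d, t' j = t j) ∧ c ≤ 1 + k * (9 + 4 * L + T) := by
    intro k
    induction k with
    | zero =>
      intro i m hi hI
      obtain rfl : i = v y := by omega
      refine ⟨m, hI, fun t u h0 _ => ⟨_, t, u, Exec.loop_of_eq (by simpa using h0),
        fun _ _ => rfl, ?_⟩⟩
      simp [h0]
    | succ k ih =>
      intro i m hi hI
      obtain ⟨m1, hI1, hr⟩ := hp i (by omega) m hI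
      obtain ⟨m2, hI2, hl⟩ := ih (i + 1) m1 (by omega) hI1
      refine ⟨m2, hI2, fun t u h0 h1 => ?_⟩
      have e1 := exec_copy_even_odd (Function.update v x u) t m x (d + 1)
      rw [h1, Function.update_idem] at e1
      obtain ⟨c2, t2, e2, h2, hc2⟩ := hr t
      have e3 := exec_const_odd (Function.update v x i) t2 m1 (d + 2) 1
      set t3 := Function.update t2 (d + 2) 1 with ht3
      have e4 := exec_op_odd (Function.update v x i) t3 m1 .add (d + 1) (d + 1) (d + 2)
      have h4 : t3 (d + 1) = i := by
        rw [ht3, Function.update_of_ne (by omega), h2 _ (by omega), h1]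
      have h4' : t3 (d + 2) = 1 := by simp [ht3]
      rw [h4, h4'] at e4
      set t4 := Function.update t3 (d + 1) (Op.add.eval i 1) with ht4
      have e5 := exec_op_odd (Function.update v x i) t4 m1 .sub d d (d + 2)
      have h5 : t4 d = k + 1 := by
        rw [ht4, Function.update_of_ne (by omega), ht3, Function.update_of_ne (by omega),
          h2 _ (by omega), h0]
      have h5' : t4 (d + 2) = 1 := by rw [ht4, Function.update_of_ne (by omega), h4']
      rw [h5, h5'] at e5
      obtain ⟨c6, t6, u6, e6, h6, hc6⟩ := hl (Function.update t4 d (Op.sub.eval (k + 1) 1)) i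
        (by simp [Op.eval]) (by rw [Function.update_of_ne (by omega), ht4]; simp [Op.eval])
      refine ⟨_, t6, u6, Exec.loop_of_ne (by simp [h0])
        (e1.seq (e2.seq (e3.seq (e4.seq e5)))) e6, fun j hj => ?_, ?_⟩
      · rw [h6 j hj, Function.update_of_ne (by omega), ht4, Function.update_of_ne (by omega), ht3,
          Function.update_of_ne (by omega), h2 j (by omega)]
      · have hs : ∀ z ≤ v y, Nat.size z ≤ L := fun z hz =>
          Nat.size_le.2 ((hz.trans (hv y)).trans_lt L.lt_two_pow_self)
        have s1 := hs (k + 1) (by omega)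
        have s2 := hs i (by omega)
        have c1 : Nat.size 1 = 1 := by simp
        rw [add_mul k 1, one_mul]
        simp only [State.mk'_odd, h0, Op.cost, c1]
        omega
  obtain ⟨m', hI, hl⟩ := hloop (v y) 0 m (by omega) hm
  refine ⟨m', hI, fun t => ?_⟩
  have e1 := exec_copy_odd_even v t m d y
  have e2 := exec_const_odd v (Function.update t d (v y)) m (d + 1) 0
  obtain ⟨c3, t3, u3, e3, h3, hc3⟩ := hl
    (Function.update (Function.update t d (v y)) (d + 1) 0) (v x) (by simp) (by simp)
  rw [Function.update_eq_self] at e3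
  have e4 := exec_const_even (Function.update v x u3) t3 m' x 0
  rw [Function.update_idem] at e4
  refine ⟨_, t3, e1.seq (e2.seq (e3.seq e4)), fun j hj => ?_, ?_⟩
  · rw [h3 j hj, Function.update_of_ne (by omega), Function.update_of_ne (by omega)]
  · have hs : Nat.size (v y) ≤ L := Nat.size_le.2 ((hv y).trans_lt L.lt_two_pow_self)
    have := Nat.mul_le_mul_right (9 + 4 * L + T) (hv y)
    have c0 : Nat.size 0 = 0 := by simp
    unfold forTime
    omega

/-- The program that runs `p` for all values of `M[0]` below the value of `e`, in decreasing
order. -/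
def countdownProg (e : Expr) (d : ℕ) (p : Prog) : Prog :=
  .seq (e.compile d) <|
  .loop (2 * d + 1) <|
    .seq (.instr (.const (2 * (d + 1) + 1) 1)) <|
    .seq (.instr (.op .sub (2 * d + 1) (2 * d + 1) (2 * (d + 1) + 1))) <|
    .seq (.instr (.const (2 * (d + 1) + 1) 0)) <|
    .seq (.instr (.store (2 * (d + 1) + 1) (2 * d + 1))) <|
    p

/-- A bound for the time of `countdownProg`, for `W` rounds. -/
def countdownTime (e : Expr) (L W T : ℕ) : ℕ := e.time L + 1 + W * (7 + 3 * e.bits L + T)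

/-- Table indices may exceed `L`, so they cannot be values of a variable. The index lives in memory
cell `0`, where only its binary length is limited. All exponentially long loops have this form. -/
theorem runs_countdownProg {v m : ℕ → ℕ} {d L W T : ℕ} {e : Expr} {p : Prog} (hv : ∀ x, v x ≤ L)
    (hm : ∀ i, m i < 2 ^ L) (hW : e.eval m v = W)
    (I : ℕ → (ℕ → ℕ) → Prop)
    (hp : ∀ k < W, ∀ m, I (k + 1) m → ∃ m', I k m' ∧
      Runs (d + 1) p v (Function.update m 0 k) v m' T)
    (hI : I W m) :
    ∃ m', I 0 m' ∧ Runs d (countdownProg e d p) v m v m' (countdownTime e L W T) := by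
  have hlt := e.eval_lt hm hv
  rw [hW] at hlt
  have hloop : ∀ k m, k ≤ W → I k m → ∃ m', I 0 m' ∧ ∀ t, t d = k →
      ∃ c t', Exec (.loop (2 * d + 1) <|
        .seq (.instr (.const (2 * (d + 1) + 1) 1)) <|
        .seq (.instr (.op .sub (2 * d + 1) (2 * d + 1) (2 * (d + 1) + 1))) <|
        .seq (.instr (.const (2 * (d + 1) + 1) 0)) <|
        .seq (.instr (.store (2 * (d + 1) + 1) (2 * d + 1))) <| p)
        (State.mk' v t m) c (State.mk' v t' m') ∧
      (∀ j < d, t' j = t j) ∧ c ≤ 1 + k * (7 + 3 * e.bits L + T) := by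
    intro k
    induction k with
    | zero =>
      intro m _ hI
      refine ⟨m, hI, fun t h0 => ⟨_, t, Exec.loop_of_eq (by simpa using h0), fun _ _ => rfl, ?_⟩⟩
      simp [h0]
    | succ k ih =>
      intro m hk hI
      obtain ⟨m1, hI1, hr⟩ := hp k (by omega) m hI
      obtain ⟨m2, hI2, hl⟩ := ih m1 (by omega) hI1
      refine ⟨m2, hI2, fun t h0 => ?_⟩
      have e1 := exec_const_odd v t m (d + 1) 1
      have e2 := exec_op_odd v (Function.update t (d + 1) 1) m .sub d d (d + 1)
      rw [Function.update_of_ne (by omega), h0, Function.update_self] at e2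
      have e3 := exec_const_odd v (Function.update (Function.update t (d + 1) 1) d
        (Op.sub.eval (k + 1) 1)) m (d + 1) 0
      set t3 := Function.update (Function.update (Function.update t (d + 1) 1) d
        (Op.sub.eval (k + 1) 1)) (d + 1) 0 with ht3
      have h3 : t3 d = k := by
        rw [ht3, Function.update_of_ne (by omega)]; simp [Op.eval]
      have h3' : t3 (d + 1) = 0 := by simp [ht3]
      have e4 := exec_store_odd v t3 m (d + 1) d
      rw [h3, h3'] at e4
      obtain ⟨c5, t5, e5, h5, hc5⟩ := hr t3
      obtain ⟨c6, t6, e6, h6, hc6⟩ := hl t5 (by rw [h5 d (by omega), h3])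
      refine ⟨_, t6, Exec.loop_of_ne (by simp [h0])
        (e1.seq (e2.seq (e3.seq (e4.seq e5)))) e6, fun j hj => ?_, ?_⟩
      · rw [h6 j hj, h5 j (by omega), ht3, Function.update_of_ne (by omega),
          Function.update_of_ne (by omega), Function.update_of_ne (by omega)]
      · have s1 : Nat.size (k + 1) ≤ e.bits L := Nat.size_le.2 (by omega)
        have s2 : Nat.size k ≤ e.bits L := Nat.size_le.2 (by omega)
        have c1 : Nat.size 1 = 1 := by simp
        have c0 : Nat.size 0 = 0 := by simp
        rw [add_mul k 1, one_mul]
        simp only [State.mk'_odd, h0, Op.cost, c1, c0]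
        omega
  obtain ⟨m', hI', hl⟩ := hloop W m le_rfl hI
  refine ⟨m', hI', fun t => ?_⟩
  obtain ⟨c1, t1, e1, h1, h1', hc1⟩ := e.computes_compile hm d hv t
  obtain ⟨c2, t2, e2, h2, hc2⟩ := hl t1 (h1'.trans hW)
  exact ⟨_, t2, e1.seq e2, fun j hj => (h2 j hj).trans (h1 j hj), by unfold countdownTime; omega⟩

theorem polyBounded_storeTime (a e : Expr) : PolyBounded (storeTime a e) :=
  (a.polyBounded_time.add e.polyBounded_time).add
    (((PolyBounded.const 1).add a.polyBounded_bits).add e.polyBounded_bits)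

theorem polyBounded_assignTime (e : Expr) : PolyBounded (assignTime e) :=
  e.polyBounded_time.add ((PolyBounded.const 2).add e.polyBounded_bits)

/-! ### Derived expressions: remainders and comparisons. -/

namespace Expr

instance : Add Expr := ⟨op .add⟩
instance : Sub Expr := ⟨op .sub⟩
instance : Mul Expr := ⟨op .mul⟩
instance : Div Expr := ⟨op .div⟩
instance : Zero Expr := ⟨const 0⟩
instance : One Expr := ⟨const 1⟩

/-- The remainder of a division. -/
def mod (a b : Expr) : Expr := a - a / b * b

/-- `c` if `a = b`, and `d` otherwise. -/
def ifEq (a b c d : Expr) : Expr := ite ((a - b) + (b - a)) d c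

/-- `c` if `a < b`, and `d` otherwise. -/
def ifLt (a b c d : Expr) : Expr := ite (b - a) c d

section eval

variable (m v : ℕ → ℕ) (a b c d : Expr) (x y k : ℕ)

@[simp] theorem eval_add : (a + b).eval m v = a.eval m v + b.eval m v := rfl
@[simp] theorem eval_sub : (a - b).eval m v = a.eval m v - b.eval m v := rfl
@[simp] theorem eval_mul : (a * b).eval m v = a.eval m v * b.eval m v := rfl
@[simp] theorem eval_div : (a / b).eval m v = a.eval m v / b.eval m v := rfl
@[simp] theorem eval_zero : (0 : Expr).eval m v = 0 := rfl
@[simp] theorem eval_one : (1 : Expr).eval m v = 1 := rfl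
@[simp] theorem eval_const : (const k).eval m v = k := rfl
@[simp] theorem eval_var : (var x).eval m v = v x := rfl
@[simp] theorem eval_load : (load a).eval m v = m (a.eval m v) := rfl
@[simp] theorem eval_ite :
    (ite a b c).eval m v = if a.eval m v = 0 then c.eval m v else b.eval m v := rfl
@[simp] theorem eval_sum : (sum x y a).eval m v =
    ∑ i ∈ Finset.range (v y), a.eval m (Function.update v x i) := rfl
@[simp] theorem eval_prod : (prod x y a).eval m v =
    ∏ i ∈ Finset.range (v y), a.eval m (Function.update v x i) := rfl

@[simp] theorem eval_mod : (mod a b).eval m v = a.eval m v % b.eval m v := by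
  simp only [mod, eval_sub, eval_mul, eval_div]
  rw [Nat.mod_eq_sub_div_mul]

@[simp] theorem eval_ifEq : (ifEq a b c d).eval m v =
    if a.eval m v = b.eval m v then c.eval m v else d.eval m v := by
  simp only [ifEq, eval_ite, eval_add, eval_sub]
  congr 1
  exact propext (by omega)

@[simp] theorem eval_ifLt : (ifLt a b c d).eval m v =
    if a.eval m v < b.eval m v then c.eval m v else d.eval m v := by
  rw [ifLt, eval_ite]
  by_cases h : a.eval m v < b.eval m v
  · rw [if_pos h, if_neg (by rw [eval_sub]; omega)]
  · rw [if_neg h, if_pos (by rw [eval_sub]; omega)]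

end eval

end Expr

open ConflictFree.Expr

/-! ### The contents of the variables and of the memory

The variables `1` to `4` hold the number of vertices, the number of nodes, their product, and the
number of states of a vertex. The variable `5` holds the current step of the elimination. The
variables with larger numbers are bound in sums and products. -/

/-- The values of the first variables. -/
structure Env (n N Q : ℕ) (v : ℕ → ℕ) : Prop where
  one : v 1 = n
  two : v 2 = N
  three : v 3 = n * N
  four : v 4 = Q

theorem Env.update {n N Q : ℕ} {v : ℕ → ℕ} (hv : Env n N Q v) {x : ℕ} (hx : 5 ≤ x) (k : ℕ) :
    Env n N Q (Function.update v x k) := by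
  constructor <;> rw [Function.update_of_ne (by omega)]
  exacts [hv.one, hv.two, hv.three, hv.four]

/-- The end of the input in the memory. -/
def base (n N : ℕ) : ℕ := 2 + n * n + N * N + N * n

/-- The memory holds the adjacency relation `A` of the vertices and the incidence relation `D` of
the nodes and the vertices. -/
structure Holds (n N : ℕ) (A D : ℕ → ℕ → Prop) (m : ℕ → ℕ) : Prop where
  adj : ∀ x < n, ∀ y < n, m (2 + x * n + y) = 0 ↔ ¬ A x y
  bag : ∀ u < N, ∀ x < n, m (2 + n * n + N * N + u * n + x) = 0 ↔ ¬ D u x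

theorem add_mul_add_lt {s a b k l : ℕ} (ha : a < k) (hb : b < l) : s + a * l + b < s + k * l := by
  nlinarith

/-- The cells `0` and `1` are exempt: once `n` and `N` are held in variables, cell `0` is free to
serve as loop index. -/
theorem Holds.congr {n N : ℕ} {A D : ℕ → ℕ → Prop} {m m' : ℕ → ℕ} (hm : Holds n N A D m)
    (h : ∀ a, 2 ≤ a → a < base n N → m' a = m a) : Holds n N A D m' where
  adj x hx y hy := by
    rw [h _ (by omega), hm.adj x hx y hy]
    have := add_mul_add_lt (s := 2) hx hy
    unfold base; omega
  bag u hu x hx := by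
    rw [h _ (by omega), hm.bag u hu x hx]
    have := add_mul_add_lt (s := 2 + n * n + N * N) hu hx
    unfold base; omega

/-- The entry of the adjacency matrix. -/
def adjE (a b : Expr) : Expr := load (const 2 + a * var 1 + b)

/-- The entry of the incidence matrix. -/
def bagE (u x : Expr) : Expr := load (const 2 + var 1 * var 1 + var 2 * var 2 + u * var 1 + x)

/-- The end of the input in the memory. -/
def baseE : Expr := const 2 + var 1 * var 1 + var 2 * var 2 + var 2 * var 1

/-- The vertex that is eliminated in step `j`. -/
def ordE (j : Expr) : Expr := load (baseE + j) / var 2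

/-- The node that is used for the elimination in step `j`. -/
def ownE (j : Expr) : Expr := mod (load (baseE + j)) (var 2)

section eval

variable {n N Q : ℕ} {A D : ℕ → ℕ → Prop} {m v : ℕ → ℕ} (hv : Env n N Q v)
include hv

theorem eval_adjE (hm : Holds n N A D m) {a b : Expr} (ha : a.eval m v < n) (hb : b.eval m v < n) :
    (adjE a b).eval m v = 0 ↔ ¬ A (a.eval m v) (b.eval m v) := by
  simpa [adjE, hv.one] using hm.adj _ ha _ hb

theorem eval_bagE (hm : Holds n N A D m) {u x : Expr} (hu : u.eval m v < N)
    (hx : x.eval m v < n) : (bagE u x).eval m v = 0 ↔ ¬ D (u.eval m v) (x.eval m v) := by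
  simpa [bagE, hv.one, hv.two] using hm.bag _ hu _ hx

theorem eval_baseE : baseE.eval m v = base n N := by simp [baseE, base, hv.one, hv.two]

theorem eval_ordE (j : Expr) : (ordE j).eval m v = m (base n N + j.eval m v) / N := by
  simp [ordE, eval_baseE hv, hv.two]

theorem eval_ownE (j : Expr) : (ownE j).eval m v = m (base n N + j.eval m v) % N := by
  simp [ownE, eval_baseE hv, hv.two]

end eval

/-! ### The search for an elimination order -/

/-- The vertex `x` has not been eliminated before the step given by variable `5`. -/
def aliveE (x : Expr) : Expr := prod 6 5 (ifEq (ordE (var 6)) x 0 1)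

/-- The vertex and the node encoded by `c` can be used for an elimination step. -/
def okE (c : Expr) : Expr :=
  aliveE (c / var 2) * prod 7 2 (ite (bagE (var 7) (c / var 2))
    (prod 8 1 (ite (aliveE (var 8) * bagE (var 7) (var 8)) (bagE (mod c (var 2)) (var 8)) 1)) 1)

/-- The first vertex and node that can be used for an elimination step. -/
def searchE : Expr :=
  sum 9 3 (ite (okE (var 9)) (prod 10 9 (ite (okE (var 10)) 0 1) * var 9) 0)

/-- The vertex `c / N` and the node `c % N` can be used for the next elimination step, if the
vertices of `E` have been eliminated. -/
def CanEliminate (n N : ℕ) (D : ℕ → ℕ → Prop) (E : ℕ → Prop) (c : ℕ) : Prop :=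
  ¬ E (c / N) ∧ ∀ w < N, D w (c / N) → ∀ x < n, ¬ E x → D w x → D (c % N) x

/-- The inner product kills every index that has a success before it, so only the least success
contributes. This makes a search expressible as a bounded sum. -/
theorem exists_search_eq {M : ℕ} {p : ℕ → ℕ} (h : ∃ c < M, p c ≠ 0) :
    ∃ c < M, p c ≠ 0 ∧ ∑ c ∈ Finset.range M, (if p c = 0 then 0 else
      (∏ c' ∈ Finset.range c, if p c' = 0 then 1 else 0) * c) = c := by
  classical
  have hf := Nat.find_spec h
  set c := Nat.find h with hc
  refine ⟨c, hf.1, hf.2, ?_⟩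
  rw [Finset.sum_eq_single c]
  · rw [if_neg hf.2, Finset.prod_eq_one, one_mul]
    intro c' hc'
    have h1 := Finset.mem_range.1 hc'
    have h2 := Nat.find_min h h1
    rw [if_pos]
    by_contra h3
    exact h2 ⟨h1.trans hf.1, h3⟩
  · intro c' hc' hne
    split_ifs with h1
    · rfl
    · have h2 : c < c' := lt_of_le_of_ne (Nat.find_min' h ⟨Finset.mem_range.1 hc', h1⟩) hne.symm
      rw [Finset.prod_eq_zero (Finset.mem_range.2 h2) (if_neg hf.2), zero_mul]
  · exact fun h1 => absurd (Finset.mem_range.2 hf.1) h1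

section search

variable {n N Q : ℕ} {A D : ℕ → ℕ → Prop} {m v : ℕ → ℕ}

theorem eval_aliveE (hv : Env n N Q v) {x : Expr}
    (hx : ∀ k, x.eval m (Function.update v 6 k) = x.eval m v) :
    (aliveE x).eval m v = 0 ↔ ∃ j < v 5, m (base n N + j) / N = x.eval m v := by
  simp only [aliveE, eval_prod, eval_ifEq, Finset.prod_eq_zero_iff, Finset.mem_range, hx]
  simp [eval_ordE (hv.update (show 5 ≤ 6 by norm_num) _)]

/-- Bounded universal quantifiers become products that are nonzero iff all factors are. The
condition `hx` excludes capture: `c` must not depend on the variables bound inside. -/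
theorem eval_okE (hv : Env n N Q v) (hm : Holds n N A D m) {c : Expr}
    (hc : c.eval m v < n * N)
    (hx : ∀ x ∈ [6, 7, 8], ∀ v k, c.eval m (Function.update v x k) = c.eval m v) :
    (okE c).eval m v ≠ 0 ↔
      CanEliminate n N D (fun x => ∃ j < v 5, m (base n N + j) / N = x) (c.eval m v) := by
  have hN : 0 < N := Nat.pos_of_mul_pos_left (by omega : 0 < n * N)
  have h1 : c.eval m v / N < n := Nat.div_lt_of_lt_mul (by rwa [mul_comm])
  have h2 : c.eval m v % N < N := Nat.mod_lt _ hN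
  have h6 := hx 6 (by simp)
  have h7 := hx 7 (by simp)
  have h8 := hx 8 (by simp)
  rw [okE, eval_mul, mul_ne_zero_iff, Ne, eval_aliveE hv (by simp [h6]), eval_prod,
    Finset.prod_ne_zero_iff]
  simp only [CanEliminate, eval_div, eval_var, hv.two, Finset.mem_range]
  refine and_congr_right fun _ => forall₂_congr fun w hw => ?_
  have hv7 := hv.update (show 5 ≤ 7 by norm_num) w
  rw [eval_ite, eval_prod]
  have h9 := eval_bagE hv7 hm (u := var 7) (x := c / var 2) (by simpa)
    (by simpa [h7, hv.two] using h1)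
  simp only [eval_div, eval_var, hv7.two, h7, Function.update_self] at h9
  by_cases hD : D w (c.eval m v / N)
  · rw [if_neg (by rw [h9]; simpa using hD), Finset.prod_ne_zero_iff]
    simp only [hv7.one, Finset.mem_range, hD, true_imp_iff]
    refine forall₂_congr fun x hx => ?_
    have hv8 := hv7.update (show 5 ≤ 8 by norm_num) x
    have e1 := eval_aliveE (m := m) hv8 (x := var 8) (by simp)
    have e2 := eval_bagE hv8 hm (u := var 7) (x := var 8) (by simpa) (by simpa)
    have e3 := eval_bagE hv8 hm (u := mod c (var 2)) (x := var 8)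
      (by simpa [h7, h8, hv.two] using h2) (by simpa)
    simp only [eval_var, eval_mod, h7, h8, Function.update_self, ne_eq,
      not_false_eq_true, Function.update_of_ne, hv.two, Nat.reduceEqDiff] at e1 e2 e3
    rw [eval_ite, eval_mul]
    by_cases h3 : (aliveE (var 8)).eval m
        (Function.update (Function.update v 7 w) 8 x) = 0
    · rw [h3, zero_mul, if_pos rfl]
      have := e1.1 h3
      simp [this]
    · have h3' := fun h => h3 (e1.2 h)
      by_cases h4 : D w x
      · rw [if_neg (mul_ne_zero h3 (by rw [Ne, e2]; simpa using h4)), Ne, e3]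
        simp only [not_not, h4, true_imp_iff]
        exact ⟨fun h _ => h, fun h => h h3'⟩
      · rw [e2.2 h4]
        simp [h4]
  · rw [if_pos (h9.2 hD)]
    simp [hD]

theorem eval_searchE (hv : Env n N Q v) (hm : Holds n N A D m)
    (h : ∃ c < n * N, CanEliminate n N D (fun x => ∃ j < v 5, m (base n N + j) / N = x) c) :
    searchE.eval m v < n * N ∧
      CanEliminate n N D (fun x => ∃ j < v 5, m (base n N + j) / N = x) (searchE.eval m v) := by
  have ok9 : ∀ c < n * N, (okE (var 9)).eval m (Function.update v 9 c) ≠ 0 ↔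
      CanEliminate n N D (fun x => ∃ j < v 5, m (base n N + j) / N = x) c := fun c hc => by
    have := eval_okE (hv.update (show 5 ≤ 9 by norm_num) c) hm (c := var 9) (by simpa) (by simp)
    simpa using this
  obtain ⟨c, hc, hc0, hs⟩ := exists_search_eq
    (p := fun c => (okE (var 9)).eval m (Function.update v 9 c))
    (by obtain ⟨c, hc, h⟩ := h; exact ⟨c, hc, (ok9 c hc).2 h⟩)
  have : searchE.eval m v = c := by
    rw [← hs, searchE, eval_sum, hv.three]
    refine Finset.sum_congr rfl fun d _ => ?_
    simp only [eval_ite, eval_mul, eval_prod, eval_var, Function.update_self, eval_zero, eval_one]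
    -- The two uses of `okE`, with candidate variables `9` and `10`, agree by computation, since no
    -- other variable that it reads has been changed.
    congr 2
  rw [this]
  exact ⟨hc, (ok9 c hc).1 hc0⟩

end search

/-! ### The expressions for the elimination -/

/-- The memory holds the input and an elimination order: in step `j`, the vertex `o j` is
eliminated, and the node `r j` is used. -/
structure Prepared (n N : ℕ) (A D : ℕ → ℕ → Prop) (o r : ℕ → ℕ) (m : ℕ → ℕ) : Prop
    extends Holds n N A D m where
  ord_eq : ∀ j < n, m (base n N + j) / N = o j
  own_eq : ∀ j < n, m (base n N + j) % N = r j
  ord_lt : ∀ j < n, o j < n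
  own_lt : ∀ j < n, r j < N

theorem Prepared.congr {n N : ℕ} {A D : ℕ → ℕ → Prop} {o r m m' : ℕ → ℕ}
    (hm : Prepared n N A D o r m) (h : ∀ a, 2 ≤ a → a < base n N + n → m' a = m a) :
    Prepared n N A D o r m' where
  toHolds := hm.toHolds.congr fun a h1 h2 => h a h1 (by omega)
  ord_eq j hj := by rw [h _ (by unfold base; omega) (by omega), hm.ord_eq j hj]
  own_eq j hj := by rw [h _ (by unfold base; omega) (by omega), hm.own_eq j hj]
  ord_lt := hm.ord_lt
  own_lt := hm.own_lt

/-- The vertex eliminated in step `j` lies in the bag used in step `h`. -/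
def relE (h j : Expr) : Expr := bagE (ownE h) (ordE j)

/-- The power of the number of states with exponent `y`. -/
def powE (y : ℕ) : Expr := prod 20 y (var 4)

/-- The base of the number system for the counting. -/
def bigBaseE (q : ℕ) : Expr := prod 20 1 (const (q ^ 2 + 1)) * const (q ^ 2 + 1)

/-- The modulus for the counting. -/
def modulusE (q : ℕ) : Expr := prod 21 1 (bigBaseE q) * bigBaseE q

/-- The address within a table, for the digits `s` (an expression in variable `10`). -/
def codeE (h : ℕ) (s : Expr) : Expr :=
  sum 10 1 (ifLt (var h) (var 10) (ite (relE (var h) (var 10)) (s * powE 10) 0) 0)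

/-- The address of an entry in the table of step `h`. -/
def addrE (h : ℕ) (s : Expr) : Expr := baseE + var 1 + var h * powE 1 + codeE h s

/-- The number of values of the digit `j` in the current step. -/
def radixE (j : ℕ) : Expr := ite (relE (var 5) (var j)) (var 4) 1

/-- The digit `j` of the index in the current step. -/
def digitE (j : ℕ) : Expr := mod (load 0 / prod 22 j (radixE 22)) (radixE j)

/-- The number of indices in the current step. -/
def countE : Expr := prod 22 1 (radixE 22)

/-- `x` if no step after the step `h` and before `i` is related to the step `h`, and `1`
otherwise. -/
def ifFreeE (h i : ℕ) (x : Expr) : Expr :=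
  ite (prod 11 i (ifLt (var h) (var 11) (ite (relE (var h) (var 11)) 0 1) 1)) x 1

/-- `effect` as an expression. -/
def effectE (q : ℕ) (a b : Expr) : Expr :=
  ifEq (mod a (const q)) (mod (b / const q) (const q)) (ite (b / const (q ^ 2)) 0 (bigBaseE q)) 1

/-- The weight of a state. -/
def weightE (closed : Bool) (q : ℕ) (a : Expr) : Expr :=
  ite (a / const (q ^ 2)) (modulusE q - 1) 1 * if closed then effectE q a a else 1

/-- The entry for the current index in the table of the current step. -/
def entryE (closed : Bool) (q : ℕ) : Expr :=
  mod (sum 6 4 (weightE closed q (var 6) *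
    prod 7 1 (ifLt (var 5) (var 7) (ite (adjE (ordE (var 5)) (ordE (var 7)))
      (effectE q (var 6) (digitE 7) * effectE q (digitE 7) (var 6)) 1) 1) *
    prod 9 5 (ite (relE (var 9) (var 5))
      (ifFreeE 9 5 (load (addrE 9 (ifEq (var 10) (var 5) (var 6) (digitE 10))))) 1)))
    (modulusE q)

/-- The answer. -/
def answerE (q : ℕ) : Expr :=
  ite (mod (prod 9 1 (ifFreeE 9 1 (load (addrE 9 0)))) (modulusE q)) 1 0

/-- The base of the number system for the counting. -/
def bigBase (q n : ℕ) : ℕ := (q ^ 2 + 1) ^ (n + 1)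

/-- The modulus for the counting. -/
def modulus (q n : ℕ) : ℕ := bigBase q n ^ (n + 1)

open Classical in
/-- The number with the digits `s` at the later positions related to `h`. -/
noncomputable def code (n Q : ℕ) (b : ℕ → ℕ → Prop) (h : ℕ) (s : ℕ → ℕ) : ℕ :=
  ∑ k ∈ Finset.range n, if h < k ∧ b h k then s k * Q ^ k else 0

/-- The address of an entry in the table of the step `h`. -/
noncomputable def addr (n N Q : ℕ) (b : ℕ → ℕ → Prop) (h : ℕ) (s : ℕ → ℕ) : ℕ :=
  base n N + n + h * Q ^ n + code n Q b h s

open Classical in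
/-- The number of values of the digit `j` of an index in step `i`. -/
noncomputable def radix (Q : ℕ) (b : ℕ → ℕ → Prop) (i j : ℕ) : ℕ := if b i j then Q else 1

/-- The digit `j` of an index in step `i`. -/
noncomputable def digit (Q : ℕ) (b : ℕ → ℕ → Prop) (i idx j : ℕ) : ℕ :=
  idx / (∏ l ∈ Finset.range j, radix Q b i l) % radix Q b i j

/-- The weight of a state, as a natural number. -/
def weight (closed : Bool) (q n a : ℕ) : ℕ :=
  (if a / q ^ 2 = 0 then 1 else modulus q n - 1) * if closed then effect q (bigBase q n) a a else 1

/-! ### Values of the expressions for the elimination. -/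

section eval

variable {n N Q : ℕ} {A D : ℕ → ℕ → Prop} {o r m v : ℕ → ℕ} (hv : Env n N Q v)
include hv

theorem eval_powE (y : ℕ) : (powE y).eval m v = Q ^ v y := by
  simp [powE, hv.four]

theorem eval_bigBaseE (q : ℕ) : (bigBaseE q).eval m v = bigBase q n := by
  simp [bigBaseE, bigBase, hv.one, pow_succ]

theorem eval_modulusE (q : ℕ) : (modulusE q).eval m v = modulus q n := by
  simp only [modulusE, eval_mul, eval_prod, eval_bigBaseE hv, hv.one, modulus,
    eval_bigBaseE (hv.update (show 5 ≤ 21 by norm_num) _)]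
  simp [pow_succ]

theorem eval_effectE (q : ℕ) (a b : Expr) :
    (effectE q a b).eval m v = effect q (bigBase q n) (a.eval m v) (b.eval m v) := by
  simp [effectE, effect, eval_bigBaseE hv]

theorem eval_weightE (closed : Bool) (q : ℕ) (a : Expr) :
    (weightE closed q a).eval m v = weight closed q n (a.eval m v) := by
  cases closed <;> simp [weightE, weight, eval_effectE hv, eval_modulusE hv]

variable (hm : Prepared n N A D o r m)
include hm

theorem eval_relE {h j : Expr} (hh : h.eval m v < n) (hj : j.eval m v < n) :
    (relE h j).eval m v = 0 ↔ ¬ D (r (h.eval m v)) (o (j.eval m v)) := by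
  have h1 : (ownE h).eval m v = r (h.eval m v) := by rw [eval_ownE hv, hm.own_eq _ hh]
  have h2 : (ordE j).eval m v = o (j.eval m v) := by rw [eval_ordE hv, hm.ord_eq _ hj]
  rw [relE, eval_bagE hv hm.toHolds (by rw [h1]; exact hm.own_lt _ hh)
    (by rw [h2]; exact hm.ord_lt _ hj), h1, h2]

/-- The digit expression `s` is evaluated under the binder of variable `10`, hence the form of `hs`;
`h ≠ 10` prevents capture. -/
theorem eval_codeE {h : ℕ} (hh : v h < n) (h10 : h ≠ 10) {s : Expr} {f : ℕ → ℕ}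
    (hs : ∀ k < n, s.eval m (Function.update v 10 k) = f k) :
    (codeE h s).eval m v = code n Q (fun h j => D (r h) (o j)) (v h) f := by
  rw [codeE, eval_sum, hv.one, code]
  refine Finset.sum_congr rfl fun k hk => ?_
  have hk := Finset.mem_range.1 hk
  have hv' := hv.update (show 5 ≤ 10 by norm_num) k
  have hr := eval_relE hv' hm (h := var h) (j := var 10)
    (by simpa [Function.update_of_ne h10]) (by simpa)
  simp only [eval_var, Function.update_of_ne h10, Function.update_self] at hr
  rw [eval_ifLt, eval_ite, eval_mul, eval_powE hv', hs k hk]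
  simp only [eval_var, Function.update_of_ne h10, Function.update_self, eval_zero]
  by_cases h1 : v h < k
  · by_cases h2 : D (r (v h)) (o k)
    · rw [if_pos h1, if_neg (by rw [hr]; simpa using h2), if_pos ⟨h1, h2⟩]
    · rw [if_pos h1, if_pos (hr.2 h2), if_neg (fun h => h2 h.2)]
  · rw [if_neg h1, if_neg (fun h => h1 h.1)]

theorem eval_addrE {h : ℕ} (hh : v h < n) (h10 : h ≠ 10) {s : Expr} {f : ℕ → ℕ}
    (hs : ∀ k < n, s.eval m (Function.update v 10 k) = f k) :
    (addrE h s).eval m v = addr n N Q (fun h j => D (r h) (o j)) (v h) f := by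
  simp only [addrE, eval_add, eval_mul, eval_baseE hv, eval_var, eval_powE hv, hv.one,
    eval_codeE hv hm hh h10 hs, addr]

theorem eval_radixE (h5 : v 5 < n) {j : ℕ} (hj : v j < n) :
    (radixE j).eval m v = radix Q (fun h j => D (r h) (o j)) (v 5) (v j) := by
  rw [radixE, eval_ite, radix]
  have hr := eval_relE hv hm (h := var 5) (j := var j) h5 hj
  simp only [eval_var] at hr
  by_cases h : D (r (v 5)) (o (v j))
  · rw [if_pos h, if_neg (by rw [hr]; simpa using h), eval_var, hv.four]
  · rw [if_neg h, if_pos (hr.2 h), eval_one]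

theorem eval_prod_radixE (h5 : v 5 < n) {j : ℕ} (hj : v j ≤ n) :
    (prod 22 j (radixE 22)).eval m v =
      ∏ l ∈ Finset.range (v j), radix Q (fun h j => D (r h) (o j)) (v 5) l := by
  rw [eval_prod]
  refine Finset.prod_congr rfl fun l hl => ?_
  have hl := Finset.mem_range.1 hl
  rw [eval_radixE (hv.update (show 5 ≤ 22 by norm_num) l) hm (by simpa) (by simp; omega)]
  simp

theorem eval_countE (h5 : v 5 < n) : countE.eval m v =
    ∏ l ∈ Finset.range n, radix Q (fun h j => D (r h) (o j)) (v 5) l := by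
  rw [countE, eval_prod_radixE hv hm h5 hv.one.le, hv.one]

theorem eval_digitE (h5 : v 5 < n) {j : ℕ} (hj : v j < n) :
    (digitE j).eval m v = digit Q (fun h j => D (r h) (o j)) (v 5) (m 0) (v j) := by
  rw [digitE, eval_mod, eval_div, eval_radixE hv hm h5 hj, eval_prod_radixE hv hm h5 hj.le,
    eval_load, eval_zero, digit]

open Classical in
theorem eval_ifFreeE {h i : ℕ} (hh : v h < n) (hi : v i ≤ n) (h11 : h ≠ 11) (x : Expr) :
    (ifFreeE h i x).eval m v =
      if ∀ k < v i, v h < k → ¬ D (r (v h)) (o k) then x.eval m v else 1 := by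
  have key : (prod 11 i (ifLt (var h) (var 11) (ite (relE (var h) (var 11)) 0 1) 1)).eval m v = 0 ↔
      ¬ ∀ k < v i, v h < k → ¬ D (r (v h)) (o k) := by
    rw [eval_prod, Finset.prod_eq_zero_iff]
    push Not
    refine exists_congr fun k => ?_
    rw [Finset.mem_range]
    refine and_congr_right fun hk => ?_
    have hr := eval_relE (hv.update (show 5 ≤ 11 by norm_num) k) hm (h := var h) (j := var 11)
      (by simpa [Function.update_of_ne h11]) (by simp; omega)
    simp only [eval_var, Function.update_of_ne h11, Function.update_self] at hr
    rw [eval_ifLt, eval_ite]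
    simp only [eval_var, Function.update_of_ne h11, Function.update_self, eval_zero, eval_one]
    by_cases h1 : v h < k
    · by_cases h2 : D (r (v h)) (o k)
      · rw [if_pos h1, if_neg (by rw [hr]; simpa using h2)]; simp [h1, h2]
      · rw [if_pos h1, if_pos (hr.2 h2)]; simp [h2]
    · rw [if_neg h1]; simp [h1]
  rw [ifFreeE, eval_ite, eval_one]
  by_cases h1 : ∀ k < v i, v h < k → ¬ D (r (v h)) (o k)
  · rw [if_pos h1, if_neg (by rw [key]; simpa using h1)]
  · rw [if_neg h1, if_pos (key.2 h1)]

-- This is the recursion `factor_eq` in natural numbers: the factors of the children are read from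
-- their tables, with the digit of the current position replaced by the state `a` being summed over.
open Classical in
theorem eval_entryE (closed : Bool) (q : ℕ) (h5 : v 5 < n) :
    (entryE closed q).eval m v = (∑ a ∈ Finset.range Q, weight closed q n a *
      (∏ j ∈ Finset.range n, if v 5 < j ∧ A (o (v 5)) (o j) then
        effect q (bigBase q n) a (digit Q (fun h j => D (r h) (o j)) (v 5) (m 0) j) *
        effect q (bigBase q n) (digit Q (fun h j => D (r h) (o j)) (v 5) (m 0) j) a else 1) *
      ∏ h ∈ Finset.range (v 5), if IsParent (fun h j => D (r h) (o j)) h (v 5) then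
        m (addr n N Q (fun h j => D (r h) (o j)) h (Function.update
          (digit Q (fun h j => D (r h) (o j)) (v 5) (m 0)) (v 5) a)) else 1) % modulus q n := by
  rw [entryE, eval_mod, eval_modulusE hv, eval_sum, hv.four]
  congr 1
  refine Finset.sum_congr rfl fun a _ => ?_
  have hv6 := hv.update (show 5 ≤ 6 by norm_num) a
  rw [eval_mul, eval_mul, eval_weightE hv6, eval_prod, eval_prod, hv6.one,
    Function.update_of_ne (show 5 ≠ 6 by norm_num), eval_var, Function.update_self]
  congr 1
  · congr 1
    refine Finset.prod_congr rfl fun j hj => ?_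
    have hj := Finset.mem_range.1 hj
    have hv7 := hv6.update (show 5 ≤ 7 by norm_num) j
    have ho5 : (ordE (var 5)).eval m (Function.update (Function.update v 6 a) 7 j) = o (v 5) := by
      rw [eval_ordE hv7]; simpa using hm.ord_eq _ h5
    have ho7 : (ordE (var 7)).eval m (Function.update (Function.update v 6 a) 7 j) = o j := by
      rw [eval_ordE hv7]; simpa using hm.ord_eq _ hj
    have hadj := eval_adjE hv7 hm.toHolds (a := ordE (var 5)) (b := ordE (var 7))
      (by rw [ho5]; exact hm.ord_lt _ h5) (by rw [ho7]; exact hm.ord_lt _ hj)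
    rw [ho5, ho7] at hadj
    rw [eval_ifLt, eval_ite, eval_mul, eval_effectE hv7, eval_effectE hv7,
      eval_digitE hv7 hm (by simpa) (by simpa)]
    simp only [eval_var, Function.update_self, ne_eq, not_false_eq_true, Function.update_of_ne,
      Nat.reduceEqDiff, eval_one]
    by_cases h1 : v 5 < j
    · by_cases h2 : A (o (v 5)) (o j)
      · rw [if_pos h1, if_neg (by rw [hadj]; simpa using h2), if_pos ⟨h1, h2⟩]
      · rw [if_pos h1, if_pos (hadj.2 h2), if_neg (fun h => h2 h.2)]
    · rw [if_neg h1, if_neg (fun h => h1 h.1)]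
  · refine Finset.prod_congr rfl fun h hh => ?_
    have hh := Finset.mem_range.1 hh
    have hv9 := hv6.update (show 5 ≤ 9 by norm_num) h
    have hr := eval_relE hv9 hm (h := var 9) (j := var 5) (by simp; omega) (by simpa)
    have hw5 : Function.update (Function.update v 6 a) 9 h 5 = v 5 := by simp
    have hw9 : Function.update (Function.update v 6 a) 9 h 9 = h := by simp
    simp only [eval_var, hw5, hw9] at hr
    rw [eval_ite, eval_ifFreeE hv9 hm (by omega) (by omega) (by norm_num), eval_load,
      eval_addrE hv9 hm (by omega) (by norm_num) (f := Function.update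
          (digit Q (fun h j => D (r h) (o j)) (v 5) (m 0)) (v 5) a), hw5, hw9, eval_one]
    · by_cases h1 : D (r h) (o (v 5))
      · rw [if_neg (by rw [hr]; simpa using h1)]
        by_cases h2 : ∀ k < v 5, h < k → ¬ D (r h) (o k)
        · rw [if_pos h2, if_pos ⟨h1, h2⟩]
        · rw [if_neg h2, if_neg (fun h => h2 h.2)]
      · rw [if_pos (hr.2 h1), if_neg (fun h => h1 h.1)]
    · intro k hk
      have hv10 := hv9.update (show 5 ≤ 10 by norm_num) k
      rw [eval_ifEq, eval_digitE hv10 hm (by simpa) (by simpa)]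
      simp [Function.update_apply]

-- Only roots enter the product. Their factors depend on no later position, so the assignment `0`
-- used for reading the tables is arbitrary.
open Classical in
theorem eval_answerE (q : ℕ) : (answerE q).eval m v =
    if (∏ h ∈ Finset.range n, if ∀ k < n, h < k → ¬ D (r h) (o k) then
      m (addr n N Q (fun h j => D (r h) (o j)) h 0) else 1) % modulus q n = 0 then 0 else 1 := by
  rw [answerE, eval_ite, eval_mod, eval_modulusE hv, eval_prod, hv.one, eval_zero, eval_one,
    Finset.prod_congr rfl]
  intro h hh
  have hh := Finset.mem_range.1 hh
  have hv9 := hv.update (show 5 ≤ 9 by norm_num) h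
  rw [eval_ifFreeE hv9 hm (by simpa) (by rw [hv9.one]) (by norm_num), eval_load,
    eval_addrE hv9 hm (by simpa) (by norm_num) (f := 0) (by simp), hv9.one]
  simp

end eval

/-! ### Numbers and digits -/

theorem sum_mul_pow_lt {Q : ℕ} (n : ℕ) {s : ℕ → ℕ} (hs : ∀ k < n, s k < Q) :
    ∑ k ∈ Finset.range n, s k * Q ^ k < Q ^ n := by
  induction n with
  | zero => simp
  | succ n ih =>
    rw [Finset.sum_range_succ, pow_succ']
    have h1 := ih fun k hk => hs k (by omega)
    have h2 := Nat.mul_le_mul_right (Q ^ n) (Nat.succ_le_of_lt (hs n (by omega)))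
    rw [Nat.succ_mul] at h2
    omega

theorem eq_of_sum_mul_pow_eq {Q : ℕ} (n : ℕ) {s t : ℕ → ℕ} (hs : ∀ k < n, s k < Q)
    (ht : ∀ k < n, t k < Q)
    (h : ∑ k ∈ Finset.range n, s k * Q ^ k = ∑ k ∈ Finset.range n, t k * Q ^ k) :
    ∀ k < n, s k = t k := by
  induction n with
  | zero => simp
  | succ n ih =>
    rw [Finset.sum_range_succ, Finset.sum_range_succ] at h
    have h1 := sum_mul_pow_lt n fun k hk => hs k (by omega)
    have h2 := sum_mul_pow_lt n fun k hk => ht k (by omega)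
    have h3 : s n = t n := by
      have := congrArg (· / Q ^ n) h
      simpa [Nat.add_mul_div_right _ _ (by omega : 0 < Q ^ n), Nat.div_eq_of_lt h1,
        Nat.div_eq_of_lt h2] using this
    rw [h3, Nat.add_right_cancel_iff] at h
    intro k hk
    rcases Nat.lt_succ_iff_lt_or_eq.1 hk with hk | rfl
    · exact ih (fun k hk => hs k (by omega)) (fun k hk => ht k (by omega)) h k hk
    · exact h3

/-- Radix one is allowed. This lets an index run over all `n` positions while only the related ones
increase the number of indices. -/
theorem exists_mixed_radix (n : ℕ) {c s : ℕ → ℕ} (hs : ∀ k < n, s k < c k) :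
    ∃ x < ∏ k ∈ Finset.range n, c k, ∀ k < n, x / (∏ l ∈ Finset.range k, c l) % c k = s k := by
  induction n with
  | zero => exact ⟨0, by simp, by simp⟩
  | succ n ih =>
    obtain ⟨x, hx, hxs⟩ := ih fun k hk => hs k (by omega)
    have hpos : ∀ k ≤ n, 0 < ∏ l ∈ Finset.range k, c l := fun k hk =>
      Finset.prod_pos fun l hl => by
        have := hs l (by have := Finset.mem_range.1 hl; omega)
        omega
    refine ⟨x + (∏ l ∈ Finset.range n, c l) * s n, ?_, fun k hk => ?_⟩
    · rw [Finset.prod_range_succ]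
      have := Nat.mul_le_mul_left (∏ l ∈ Finset.range n, c l) (Nat.succ_le_of_lt (hs n (by omega)))
      rw [Nat.mul_succ] at this
      omega
    · rcases Nat.lt_succ_iff_lt_or_eq.1 hk with hk | rfl
      · have hd : (∏ l ∈ Finset.range (k + 1), c l) ∣ ∏ l ∈ Finset.range n, c l :=
          Finset.prod_dvd_prod_of_subset _ _ _ (Finset.range_subset_range.2 (by omega))
        obtain ⟨d, hd⟩ := hd
        rw [hd, Finset.prod_range_succ, mul_assoc, mul_assoc,
          Nat.add_mul_div_left _ _ (hpos k (by omega)), Nat.add_mul_mod_self_left, hxs k hk]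
      · rw [Nat.add_mul_div_left _ _ (hpos k le_rfl), Nat.div_eq_of_lt hx, zero_add,
          Nat.mod_eq_of_lt (hs k (by omega))]

/-! ### Addresses and indices of table entries. -/

section Tables

variable {n N Q : ℕ} {b : ℕ → ℕ → Prop}

open Classical in
theorem code_eq (h : ℕ) (s : ℕ → ℕ) :
    code n Q b h s = ∑ k ∈ Finset.range n, (if h < k ∧ b h k then s k else 0) * Q ^ k :=
  Finset.sum_congr rfl fun k _ => by split_ifs <;> simp

theorem code_lt {h : ℕ} {s : ℕ → ℕ} (hQ : 0 < Q) (hs : ∀ k, s k < Q) : code n Q b h s < Q ^ n := by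
  rw [code_eq]
  exact sum_mul_pow_lt n fun k _ => by split_ifs <;> simp [hs, hQ]

theorem code_congr {h : ℕ} {s t : ℕ → ℕ} (hst : ∀ k, h < k → k < n → b h k → s k = t k) :
    code n Q b h s = code n Q b h t :=
  Finset.sum_congr rfl fun k hk => by
    split_ifs with hk'
    · rw [hst k hk'.1 (Finset.mem_range.1 hk) hk'.2]
    · rfl

theorem eq_of_code_eq {h : ℕ} {s t : ℕ → ℕ} (hQ : 0 < Q) (hs : ∀ k, s k < Q) (ht : ∀ k, t k < Q)
    (hst : code n Q b h s = code n Q b h t) {k : ℕ} (hhk : h < k) (hk : k < n) (hb : b h k) :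
    s k = t k := by
  rw [code_eq, code_eq] at hst
  simpa [hhk, hb] using eq_of_sum_mul_pow_eq n (fun k _ => by split_ifs <;> simp [hs, hQ])
    (fun k _ => by split_ifs <;> simp [ht, hQ]) hst k hk

/-- Each step owns a block of `Q ^ n` addresses. The tables are sparse in these blocks, which is
affordable because an address is charged only for its length. Writing for step `i` never touches an
earlier table. -/
theorem addr_lt_addr {h i : ℕ} (hhi : h < i) {s t : ℕ → ℕ} (hQ : 0 < Q) (hs : ∀ k, s k < Q) :
    addr n N Q b h s < addr n N Q b i t := by
  have h1 := code_lt (n := n) (b := b) (h := h) hQ hs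
  have h2 := Nat.mul_le_mul_right (Q ^ n) (Nat.succ_le_of_lt hhi)
  rw [Nat.succ_mul] at h2
  unfold addr
  omega

theorem le_addr (h : ℕ) (s : ℕ → ℕ) : base n N + n ≤ addr n N Q b h s := by
  unfold addr; omega

theorem radix_pos (hQ : 0 < Q) (i j : ℕ) : 0 < radix Q b i j := by
  unfold radix; split_ifs; exacts [hQ, one_pos]

theorem radix_le (hQ : 0 < Q) (i j : ℕ) : radix Q b i j ≤ Q := by
  unfold radix; split_ifs; exacts [le_rfl, hQ]

theorem digit_lt (hQ : 0 < Q) (i idx j : ℕ) : digit Q b i idx j < Q :=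
  (Nat.mod_lt _ (radix_pos hQ i j)).trans_le (radix_le hQ i j)

theorem exists_digit_eq (i : ℕ) {s : ℕ → ℕ} (hs : ∀ k, s k < Q) :
    ∃ idx < ∏ l ∈ Finset.range n, radix Q b i l, ∀ k < n, b i k → digit Q b i idx k = s k := by
  classical
  obtain ⟨x, hx, h⟩ := exists_mixed_radix n (c := radix Q b i)
    (s := fun k => if b i k then s k else 0)
    (fun k _ => by simp only [radix]; split_ifs <;> simp [hs])
  exact ⟨x, hx, fun k hk hb => by rw [digit, h k hk, if_pos hb]⟩

end Tables

/-! ### The first phase: an elimination order -/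

theorem CanEliminate.congr {n N : ℕ} {D : ℕ → ℕ → Prop} {E E' : ℕ → Prop} {c : ℕ}
    (h : CanEliminate n N D E c) (hE : ∀ x, E x ↔ E' x) : CanEliminate n N D E' c := by
  obtain rfl : E = E' := funext fun x => propext (hE x)
  exact h

theorem exists_not_eliminated {n k : ℕ} (hk : k < n) (o : ℕ → ℕ) : ∃ x < n, ¬ ∃ j < k, o j = x := by
  by_contra h
  push Not at h
  have hsub : Finset.range n ⊆ (Finset.range k).image o := fun x hx => by
    obtain ⟨j, hj, hjx⟩ := h x (Finset.mem_range.1 hx)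
    exact Finset.mem_image.2 ⟨j, Finset.mem_range.2 hj, hjx⟩
  have := (Finset.card_le_card hsub).trans Finset.card_image_le
  simp at this
  omega

/-- The program that computes an elimination order. -/
def orderProg : Prog := forProg 5 1 0 (storeProg (baseE + var 5) searchE 2)

/-- Before step `n` some vertex is still alive, so `hE` supplies a candidate at every step. A greedy
choice suffices, since `hE` holds for whichever set has been eliminated so far. -/
theorem runs_orderProg {n N Q L : ℕ} {A D : ℕ → ℕ → Prop} {v m : ℕ → ℕ} (hv : Env n N Q v)
    (hL : ∀ x, v x ≤ L) (hm : Holds n N A D m) (hmL : ∀ a, m a < 2 ^ L)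
    (hE : ∀ E : ℕ → Prop, (∃ x < n, ¬ E x) → ∃ c < n * N, CanEliminate n N D E c) :
    ∃ m' o r, Prepared n N A D o r m' ∧ (∀ a, m' a < 2 ^ L) ∧
      (∀ i < n, ∀ j < i, o j ≠ o i) ∧
      (∀ i < n, ∀ w < N, D w (o i) → ∀ x < n, (∀ j < i, o j ≠ x) → D w x → D (r i) x) ∧
      Runs 0 orderProg v m (Function.update v 5 0) m'
        (forTime L (storeTime (baseE + var 5) searchE L)) := by
  obtain ⟨m', ⟨hma, hmL', hmE⟩, hr⟩ := runs_forProg (x := 5) (y := 1) (d := 0)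
    (p := storeProg (baseE + var 5) searchE 2)
    (T := storeTime (baseE + var 5) searchE L) hL
    (fun k m' => (∀ a < base n N, m' a = m a) ∧ (∀ a, m' a < 2 ^ L) ∧
      ∀ i < k, m' (base n N + i) < n * N ∧
        CanEliminate n N D (fun x => ∃ j < i, m' (base n N + j) / N = x) (m' (base n N + i)))
    (by
      rintro k hk m1 ⟨h1, h2, h3⟩
      rw [hv.one] at hk
      have hv' := hv.update (le_refl 5) k
      have hL' : ∀ x, Function.update v 5 k x ≤ L :=
        update_le hL (hk.le.trans (hv.one ▸ hL 1))
      have hm1 : Holds n N A D m1 := hm.congr fun a _ h => h1 a h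
      obtain ⟨hlt, hel⟩ := eval_searchE hv' hm1 (by
        rw [Function.update_self]
        exact hE _ (exists_not_eliminated hk _))
      rw [Function.update_self] at hel
      have key := runs_storeProg h2 hL' (baseE + var 5) searchE 2
      rw [eval_add, eval_baseE hv', eval_var, Function.update_self] at key
      refine ⟨_, ⟨fun a ha => ?_, fun a => ?_, fun i hi => ?_⟩, key⟩
      · rw [Function.update_of_ne (by omega), h1 a ha]
      · rw [Function.update_apply]
        split_ifs
        · exact hlt.trans_le ((hv.three ▸ hL 3).trans L.lt_two_pow_self.le)
        · exact h2 a
      · have hne : ∀ j < k, Function.update m1 (base n N + k)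
            (searchE.eval m1 (Function.update v 5 k)) (base n N + j) = m1 (base n N + j) :=
          fun j hj => Function.update_of_ne (by omega) _ _
        rcases Nat.lt_succ_iff_lt_or_eq.1 hi with hi | rfl
        · rw [hne i hi]
          refine ⟨(h3 i hi).1, (h3 i hi).2.congr fun x => exists_congr fun j =>
            and_congr_right fun hj => ?_⟩
          rw [hne j (hj.trans hi)]
        · rw [Function.update_self]
          refine ⟨hlt, hel.congr fun x => exists_congr fun j => and_congr_right fun hj => ?_⟩
          rw [hne j hj])
    (m := m) ⟨fun _ _ => rfl, hmL, by simp⟩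
  rw [hv.one] at hmE
  refine ⟨m', fun j => m' (base n N + j) / N, fun j => m' (base n N + j) % N,
    ⟨hm.congr fun a _ h => hma a h, fun _ _ => rfl, fun _ _ => rfl, fun j hj => ?_, fun j hj => ?_⟩,
    hmL', fun i hi j hj he => (hmE i hi).2.1 ⟨j, hj, he⟩,
    fun i hi w hw hD x hx hE => (hmE i hi).2.2 w hw hD x hx (by push Not; exact hE), hr⟩
  · exact Nat.div_lt_of_lt_mul ((hmE j hj).1.trans_eq (mul_comm _ _))
  · have h0 : 0 < n * N := (Nat.zero_le _).trans_lt (hmE j hj).1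
    exact Nat.mod_lt _ (Nat.pos_of_mul_pos_left h0)

/-! ### The second phase: the tables -/

/-- The program that computes the tables. -/
def tableProg (closed : Bool) (q : ℕ) : Prog :=
  forProg 5 1 0 (countdownProg countE 2 (storeProg (addrE 5 (digitE 10)) (entryE closed q) 3))

/-- The factors of the elimination, modulo `modulus q n`. -/
noncomputable def stepFactor (closed : Bool) (q n : ℕ) (A D : ℕ → ℕ → Prop) (o r : ℕ → ℕ) :
    ℕ → (ℕ → ℕ) → ZMod (modulus q n) :=
  factor n (2 * q ^ 2) (fun a => (weight closed q n a : ZMod (modulus q n)))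
    (fun a c => ((effect q (bigBase q n) a c * effect q (bigBase q n) c a : ℕ) :
      ZMod (modulus q n)))
    (fun i j => A (o i) (o j)) (fun i j => D (r i) (o j))

theorem modulus_pos (q n : ℕ) : 0 < modulus q n := by unfold modulus bigBase; positivity

/-- The tables are correct for every assignment `s`, not only for those arising from indices:
address and factor both depend only on the later related positions, and on these some index agrees
with `s`. -/
theorem runs_tableProg {n N q L W : ℕ} (closed : Bool) (hq : 0 < q) {A D : ℕ → ℕ → Prop}
    {o r v m : ℕ → ℕ} (hv : Env n N (2 * q ^ 2) v)
    (hL : ∀ x, v x ≤ L) (hm : Prepared n N A D o r m) (hmL : ∀ a, m a < 2 ^ L)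
    (hM : modulus q n ≤ 2 ^ L) (hQL : (2 * q ^ 2) ^ n ≤ 2 ^ L)
    (hW : ∀ i < n, ∏ l ∈ Finset.range n, radix (2 * q ^ 2) (fun i j => D (r i) (o j)) i l ≤ W)
    (hg : ∀ i j, i < j → j < n → A (o i) (o j) → D (r i) (o j))
    (hb : ∀ i j k, i < j → j < k → k < n → D (r i) (o j) → D (r i) (o k) → D (r j) (o k)) :
    ∃ m', Prepared n N A D o r m' ∧ (∀ a, m' a < 2 ^ L) ∧
      (∀ h < n, ∀ s : ℕ → ℕ, (∀ k, s k < 2 * q ^ 2) →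
        (m' (addr n N (2 * q ^ 2) (fun i j => D (r i) (o j)) h s) : ZMod (modulus q n)) =
          stepFactor closed q n A D o r h s) ∧
      Runs 0 (tableProg closed q) v m (Function.update v 5 0) m'
        (forTime L (countdownTime countE L W
          (storeTime (addrE 5 (digitE 10)) (entryE closed q) L))) := by
  classical
  set Q := 2 * q ^ 2 with hQdef
  set b : ℕ → ℕ → Prop := fun i j => D (r i) (o j) with hbdef
  have hQ : 0 < Q := by positivity
  obtain ⟨m', ⟨h1, h2, h3⟩, hr⟩ := runs_forProg (x := 5) (y := 1) (d := 0)
    (p := countdownProg countE 2 (storeProg (addrE 5 (digitE 10)) (entryE closed q) 3))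
    (T := countdownTime countE L W (storeTime (addrE 5 (digitE 10)) (entryE closed q) L)) hL
    (fun i m' => Prepared n N A D o r m' ∧ (∀ a, m' a < 2 ^ L) ∧
      (∀ h < i, ∀ s : ℕ → ℕ, (∀ k, s k < Q) →
        (m' (addr n N Q b h s) : ZMod (modulus q n)) = stepFactor closed q n A D o r h s))
    (by
      rintro i hi m1 ⟨h1, h2, h3⟩
      rw [hv.one] at hi
      have hv' := hv.update (le_refl 5) i
      have hL' : ∀ x, Function.update v 5 i x ≤ L :=
        update_le hL (hi.le.trans (hv.one ▸ hL 1))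
      have hi5 : Function.update v 5 i 5 = i := by simp
      set W' := ∏ l ∈ Finset.range n, radix Q b i l with hW'
      obtain ⟨m2, ⟨g1, g2, g3, g4⟩, gr⟩ := runs_countdownProg (d := 2) (L := L) (e := countE)
        (p := storeProg (addrE 5 (digitE 10)) (entryE closed q) 3)
        (T := storeTime (addrE 5 (digitE 10)) (entryE closed q) L)
        (m := m1) (W := W') hL' h2
        (by rw [eval_countE hv' h1 (by simpa), hi5])
        (fun k m' => Prepared n N A D o r m' ∧ (∀ a, m' a < 2 ^ L) ∧
          (∀ h < i, ∀ s : ℕ → ℕ, (∀ k, s k < Q) →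
            (m' (addr n N Q b h s) : ZMod (modulus q n)) = stepFactor closed q n A D o r h s) ∧
          ∀ x, k ≤ x → x < W' → (m' (addr n N Q b i (digit Q b i x)) : ZMod (modulus q n)) =
            stepFactor closed q n A D o r i (digit Q b i x))
        (by
          rintro k hk m2 ⟨g1, g2, g3, g4⟩
          -- The index is written to memory, so its length must respect the bound `L`.
          have hkL : k < 2 ^ L := by
            refine hk.trans_le (le_trans ?_ hQL)
            exact (Finset.prod_le_pow_card _ _ Q fun l _ => radix_le hQ i l).trans_eq (by simp)
          set m3 := Function.update m2 0 k with hm3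
          have hm3p : Prepared n N A D o r m3 :=
            g1.congr fun a ha _ => Function.update_of_ne (by omega) _ _
          have hm3L : ∀ a, m3 a < 2 ^ L := fun a => by
            rw [hm3, Function.update_apply]; split_ifs <;> simp [hkL, g2]
          have hm3a : ∀ h s, m3 (addr n N Q b h s) = m2 (addr n N Q b h s) := fun h s =>
            Function.update_of_ne (by have := le_addr (n := n) (N := N) (Q := Q) (b := b) h s
                                      unfold base at this; omega) _ _
          have hm30 : m3 0 = k := Function.update_self _ _ _
          have key := runs_storeProg hm3L hL' (addrE 5 (digitE 10)) (entryE closed q) 3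
          rw [eval_addrE hv' hm3p (by simpa) (by norm_num) (f := digit Q b i k) (fun l hl => by
              rw [eval_digitE (hv'.update (show 5 ≤ 10 by norm_num) l) hm3p (by simpa) (by simpa)]
              simp [hm30, hbdef]), hi5, eval_entryE hv' hm3p closed q (by simpa), hi5, hm30] at key
          set e := (_ % modulus q n) with he
          have hlt : e < modulus q n := Nat.mod_lt _ (modulus_pos q n)
          have hcast : (e : ZMod (modulus q n)) =
              stepFactor closed q n A D o r i (digit Q b i k) := by
            rw [he, ZMod.natCast_mod, stepFactor, factor_eq, Nat.cast_sum]
            refine Finset.sum_congr rfl fun a ha => ?_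
            rw [Nat.cast_mul, Nat.cast_mul, Nat.cast_prod, Nat.cast_prod]
            congr 1
            · congr 1
              refine Finset.prod_congr rfl fun j _ => ?_
              rw [Nat.cast_ite, Nat.cast_one]
            · refine Finset.prod_congr rfl fun h hh => ?_
              rw [Nat.cast_ite, Nat.cast_one]
              refine if_congr Iff.rfl ?_ rfl
              rw [← hbdef, hm3a, g3 h (Finset.mem_range.1 hh)]
              · rfl
              · intro l
                rw [Function.update_apply]
                split_ifs
                · exact Finset.mem_range.1 ha
                · exact digit_lt hQ i k l
          clear_value e
          refine ⟨_, ⟨?_, fun a => ?_, fun h hh s hs => ?_, fun x hx hxW => ?_⟩, key⟩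
          · refine hm3p.congr fun a _ ha => Function.update_of_ne ?_ _ _
            have := le_addr (n := n) (N := N) (Q := Q) (b := b) i (digit Q b i k)
            exact (ha.trans_le this).ne
          · rw [Function.update_apply]
            split_ifs
            · omega
            · exact hm3L a
          · rw [Function.update_of_ne (addr_lt_addr hh hQ hs).ne, hm3a, g3 h hh s hs]
          · by_cases hc : code n Q b i (digit Q b i x) = code n Q b i (digit Q b i k)
            · have ha : addr n N Q b i (digit Q b i x) = addr n N Q b i (digit Q b i k) := by
                rw [addr, addr, hc]
              rw [ha, Function.update_self, hcast]
              refine factor_congr _ _ _ hg hb i hi fun l hl hln hbl => ?_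
              exact (eq_of_code_eq hQ (digit_lt hQ i x) (digit_lt hQ i k) hc hl hln hbl).symm
            · have hxk : x ≠ k := fun h => hc (by rw [h])
              rw [Function.update_of_ne (by
                intro h
                rw [← hbdef] at h
                unfold addr at h
                omega), hm3a, g4 x (by omega) hxW])
        ⟨h1, h2, h3, fun x hx hx' => absurd hx' (by omega)⟩
      refine ⟨m2, ⟨g1, g2, fun h hh s hs => ?_⟩, fun t => ?_⟩
      · rcases Nat.lt_succ_iff_lt_or_eq.1 hh with hh | rfl
        · exact g3 h hh s hs
        · obtain ⟨x, hx, hxs⟩ := exists_digit_eq (n := n) (b := b) h hs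
          have e1 : code n Q b h s = code n Q b h (digit Q b h x) :=
            code_congr fun k _ hk hbk => (hxs k hk hbk).symm
          have e2 : addr n N Q b h s = addr n N Q b h (digit Q b h x) := by rw [addr, addr, e1]
          rw [e2, g4 x (Nat.zero_le x) hx]
          exact factor_congr _ _ _ hg hb h hi fun k _ hk hbk => hxs k hk hbk
      · obtain ⟨c, t', he, ht, hc⟩ := gr t
        refine ⟨c, t', he, ht, hc.trans ?_⟩
        exact Nat.add_le_add_left (Nat.mul_le_mul_right _ (hW i hi)) _)
    (m := m) ⟨hm, hmL, by simp⟩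
  rw [hv.one] at h3
  exact ⟨m', h1, h2, h3, hr⟩

/-! ### The input in the memory -/

theorem getD_flatMap {α : Type*} {n : ℕ} {f : α → List ℕ} (hf : ∀ a, (f a).length = n)
    (l : List α) {i j : ℕ} (hi : i < l.length) (hj : j < n) :
    (l.flatMap f).getD (i * n + j) 0 = (f l[i]).getD j 0 := by
  induction l generalizing i with
  | nil => simp at hi
  | cons a l ih =>
    rw [List.flatMap_cons]
    cases i with
    | zero => rw [zero_mul, zero_add, List.getD_append _ _ _ _ (by rw [hf]; exact hj)]; rfl
    | succ i =>
      rw [List.getD_append_right _ _ _ _ (by rw [hf, Nat.succ_mul]; omega), hf,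
        show (i + 1) * n + j - n = i * n + j by rw [Nat.succ_mul]; omega,
        ih (by simpa using hi)]
      rfl

theorem length_matrixEntries {k n : ℕ} (R : Fin k → Fin n → Prop) :
    (matrixEntries R).length = k * n := by
  simp [matrixEntries, List.length_flatMap]

open Classical in
theorem getD_matrixEntries {k n : ℕ} (R : Fin k → Fin n → Prop) (i : Fin k) (j : Fin n) :
    (matrixEntries R).getD (i * n + j) 0 = if R i j then 1 else 0 := by
  rw [matrixEntries, getD_flatMap (n := n) (by simp) _ (by simp) j.2]
  simp [List.getD_eq_getElem?_getD]

theorem le_one_of_mem_matrixEntries {k n : ℕ} (R : Fin k → Fin n → Prop) {a : ℕ}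
    (ha : a ∈ matrixEntries R) : a ≤ 1 := by
  simp only [matrixEntries, List.mem_flatMap, List.mem_map] at ha
  obtain ⟨_, _, _, _, rfl⟩ := ha
  split_ifs <;> omega

/-! ### The relations read from the input and their properties. -/

section Input

variable {n N : ℕ} (G : SimpleGraph (Fin n)) (T : TreeDecomposition G (Fin N))

/-- The adjacency relation, on natural numbers. -/
def adjRel (x y : ℕ) : Prop := ∃ (hx : x < n) (hy : y < n), G.Adj ⟨x, hx⟩ ⟨y, hy⟩

variable {G}

/-- The incidence relation of the nodes and the vertices, on natural numbers. -/
def bagRel (u x : ℕ) : Prop := ∃ (hu : u < N) (hx : x < n), (⟨x, hx⟩ : Fin n) ∈ T.bag ⟨u, hu⟩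

theorem getD_encode_zero : (encode G T).getD 0 0 = n := rfl

theorem getD_encode_one : (encode G T).getD 1 0 = N := rfl

theorem holds_encode : Holds n N (adjRel G) (bagRel T) fun a => (encode G T).getD a 0 where
  adj x hx y hy := by
    classical
    have h := add_mul_add_lt (s := 0) hx hy
    have h1 := getD_matrixEntries G.Adj ⟨x, hx⟩ ⟨y, hy⟩
    simp only at h1
    rw [encode, List.append_assoc, List.append_assoc,
      List.getD_append_right _ _ _ _ (by simp; omega),
      List.getD_append _ _ _ _ (by rw [length_matrixEntries]; simp; omega),
      show 2 + x * n + y - [n, N].length = x * n + y by simp; omega, h1]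
    simp [adjRel, hx, hy]
  bag u hu x hx := by
    classical
    have h1 := getD_matrixEntries (fun u x => x ∈ T.bag u) ⟨u, hu⟩ ⟨x, hx⟩
    simp only at h1
    have hlen : ([n, N] ++ matrixEntries G.Adj ++ matrixEntries T.tree.Adj).length =
        2 + n * n + N * N := by
      simp [length_matrixEntries]; omega
    rw [encode, List.getD_append_right _ _ _ _ (by rw [hlen]; omega), hlen,
      show 2 + n * n + N * N + u * n + x - (2 + n * n + N * N) = u * n + x by omega, h1]
    simp [bagRel, hx, hu]

theorem getD_encode_le (a : ℕ) : (encode G T).getD a 0 ≤ n + N + 1 := by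
  have hle : ∀ x ∈ encode G T, x ≤ n + N + 1 := fun x hx => by
    simp only [encode, List.mem_append, List.mem_cons, List.not_mem_nil, or_false] at hx
    rcases hx with (((hx | hx) | hx) | hx) | hx
    · omega
    · omega
    · have := le_one_of_mem_matrixEntries _ hx; omega
    · have := le_one_of_mem_matrixEntries _ hx; omega
    · have := le_one_of_mem_matrixEntries _ hx; omega
  by_cases h : a < (encode G T).length
  · rw [List.getD_eq_getElem _ _ h]
    exact hle _ (List.getElem_mem h)
  · rw [List.getD_eq_default _ _ (by omega)]
    omega

theorem exists_canEliminate (E : ℕ → Prop) (h : ∃ x < n, ¬ E x) :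
    ∃ c < n * N, CanEliminate n N (bagRel T) E c := by
  classical
  obtain ⟨x, hx, hE⟩ := h
  obtain ⟨y, hy, u, hu⟩ := T.exists_elimination_vertex
    (A := {x : Fin n | ¬ E x}) ⟨⟨x, hx⟩, by simpa using hE⟩
  have hN : 0 < N := u.pos
  have h1 : (u + N * y : ℕ) / N = y := by
    rw [Nat.add_mul_div_left _ _ hN, Nat.div_eq_of_lt u.2, zero_add]
  have h2 : (u + N * y : ℕ) % N = u := by
    rw [Nat.add_mul_mod_self_left, Nat.mod_eq_of_lt u.2]
  -- A candidate encodes the vertex as quotient and the node as remainder modulo `N`.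
  refine ⟨u + N * y, ?_, ?_, ?_⟩
  · have := Nat.mul_le_mul_left N (Nat.succ_le_of_lt y.2)
    rw [Nat.mul_succ, mul_comm N n] at this
    have := u.2
    omega
  · rw [h1]; simpa using hy
  · rw [h1, h2]
    rintro w hw ⟨_, _, hyw⟩ z hz hEz ⟨_, _, hzw⟩
    exact ⟨u.2, hz, hu ⟨w, hw⟩ hyw ⟨z, hz⟩ (by simpa using hEz) hzw⟩

theorem exists_bagRel_of_adjRel {x y : ℕ} (h : adjRel G x y) :
    ∃ w < N, bagRel T w x ∧ bagRel T w y := by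
  obtain ⟨hx, hy, h⟩ := h
  obtain ⟨u, h1, h2⟩ := T.exists_edge_bag _ _ h
  exact ⟨u, u.2, ⟨u.2, hx, h1⟩, u.2, hy, h2⟩

/-- The radix is `Q` only at positions whose vertex lies in the bag of the node used. The order has
no repetitions, so there are at most as many such positions as vertices in the bag. -/
theorem prod_radix_le {Q : ℕ} (hQ : 0 < Q) {o : ℕ → ℕ} (ho : ∀ i < n, ∀ j < i, o j ≠ o i)
    (u : ℕ) (r : ℕ → ℕ) (i : ℕ) (hr : r i = u) :
    ∏ l ∈ Finset.range n, radix Q (fun i j => bagRel T (r i) (o j)) i l ≤ Q ^ (T.width + 1) := by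
  classical
  simp only [radix, Finset.prod_ite, Finset.prod_const, one_pow, mul_one, hr]
  refine Nat.pow_le_pow_right hQ ?_
  by_cases hu : u < N
  · have hcard : ({l ∈ Finset.range n | bagRel T u (o l)}).card ≤ (T.bag ⟨u, hu⟩).card := by
      rw [← Finset.card_map Fin.valEmbedding (s := T.bag ⟨u, hu⟩)]
      refine Finset.card_le_card_of_injOn o (fun l hl => ?_) fun i hi j hj hij => ?_
      · obtain ⟨_, _, h⟩ := (Finset.mem_filter.1 hl).2
        exact Finset.mem_map.2 ⟨_, h, rfl⟩
      · have hi := Finset.mem_range.1 (Finset.mem_filter.1 hi).1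
        have hj := Finset.mem_range.1 (Finset.mem_filter.1 hj).1
        rcases lt_trichotomy i j with h | h | h
        · exact absurd hij (ho j hj i h)
        · exact h
        · exact absurd hij.symm (ho i hi j h)
    have := Finset.le_sup (f := fun u => (T.bag u).card) (Finset.mem_univ (⟨u, hu⟩ : Fin N))
    unfold TreeDecomposition.width
    omega
  · rw [Finset.filter_false_of_mem]
    · simp
    · rintro l - ⟨h, _⟩
      exact hu h

end Input

/-! ### The number in the last step -/

theorem effect_natCast {R : Type*} [CommSemiring R] (q B a b : ℕ) :
    ((effect q B a b : ℕ) : R) = effect q (B : R) a b := by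
  unfold effect; split_ifs <;> simp

/-- The machine has no negative numbers; the sign `-1` is represented by `modulus q n - 1`. -/
theorem weight_natCast (closed : Bool) (q n a : ℕ) :
    (weight closed q n a : ZMod (modulus q n)) =
      sign q a * if closed then effect q (bigBase q n : ZMod (modulus q n)) a a else 1 := by
  have h : ((modulus q n - 1 : ℕ) : ZMod (modulus q n)) = -1 := by
    rw [Nat.cast_sub (modulus_pos q n), ZMod.natCast_self]; simp
  unfold weight sign
  rw [Nat.cast_mul, Nat.cast_ite, Nat.cast_ite, h, effect_natCast]
  simp

open Classical in
/-- The neighbourhoods of a vertex for the two kinds of colourings. -/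
noncomputable def neighbors {V : Type*} [Fintype V] (closed : Bool) (g : V → V → Prop) (v : V) :
    Finset V :=
  if closed then insert v ({u | g v u} : Finset V) else ({u | g v u} : Finset V)

-- Each edge carries the effects in both directions. A vertex of a closed neighbourhood also acts on
-- itself, and this diagonal term belongs to its weight.
open Classical in
theorem sum_weight_ne_zero_iff (closed : Bool) {q n : ℕ} (hq : 0 < q) {g : Fin n → Fin n → Prop}
    (hg : ∀ i j, g i j → g j i) (hi : ∀ i, ¬ g i i) :
    (∑ τ : Fin n → Fin (2 * q ^ 2), (∏ j, (weight closed q n (τ j) : ZMod (modulus q n))) *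
      ∏ j, ∏ k, if j < k ∧ g j k then ((effect q (bigBase q n) (τ j) (τ k) *
        effect q (bigBase q n) (τ k) (τ j) : ℕ) : ZMod (modulus q n)) else 1) ≠ 0 ↔
    ∃ c : Fin n → Fin q, ∀ v, ∃ u ∈ neighbors closed g v, ∀ w ∈ neighbors closed g v,
      w ≠ u → c u ≠ c w := by
  -- The additional factor in `bigBase` makes the inequality strict even for `n = 0`.
  have hB : (q ^ 2) ^ n < bigBase q n := by
    unfold bigBase
    calc (q ^ 2) ^ n ≤ (q ^ 2 + 1) ^ n := Nat.pow_le_pow_left (by omega) n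
      _ < _ := Nat.pow_lt_pow_right (by have := pow_pos hq 2; omega) (by omega)
  rw [← sum_ne_zero_iff hq (Fintype.card_fin n) (neighbors closed g) hB]
  have : ∀ τ : Fin n → Fin (2 * q ^ 2),
      (∏ j, (weight closed q n (τ j) : ZMod (modulus q n))) *
      (∏ j, ∏ k, if j < k ∧ g j k then ((effect q (bigBase q n) (τ j) (τ k) *
        effect q (bigBase q n) (τ k) (τ j) : ℕ) : ZMod (modulus q n)) else 1) =
      ∏ v, (sign q (τ v) * ∏ u ∈ neighbors closed g v,
        effect q (bigBase q n : ZMod (modulus q n)) (τ u) (τ v)) := by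
    intro τ
    simp only [Nat.cast_mul, effect_natCast, weight_natCast]
    rw [prod_pairs g hg hi fun j k => effect q (bigBase q n : ZMod (modulus q n)) (τ j) (τ k),
      ← Finset.prod_mul_distrib]
    refine Finset.prod_congr rfl fun v _ => ?_
    cases closed
    · simp [neighbors]
    · simp [neighbors, Finset.prod_insert, hi, mul_assoc]
  simp only [this]
  rfl

/-- The colourability in the sense of the two problems. -/
def Colorable (closed : Bool) (q : ℕ) {V : Type*} (G : SimpleGraph V) : Prop :=
  if closed then CNCFColorable q G else ONCFColorable q G

/-- The equivalence `e` will be the elimination order: the sum is taken over positions, while the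
question concerns vertices. -/
theorem colorable_iff (closed : Bool) (q : ℕ) {V W : Type*} [Fintype W] (G : SimpleGraph V)
    (e : W ≃ V) {g : W → W → Prop} (hg : ∀ x y, g x y ↔ G.Adj (e x) (e y)) :
    (∃ c : W → Fin q, ∀ v, ∃ u ∈ neighbors closed g v, ∀ w ∈ neighbors closed g v,
      w ≠ u → c u ≠ c w) ↔ Colorable closed q G := by
  classical
  obtain rfl : g = fun x y => G.Adj (e x) (e y) := funext₂ fun x y => propext (hg x y)
  cases closed
  · simp only [neighbors, Colorable, ONCFColorable, IsONCFColoring, Bool.false_eq_true, if_false]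
    rw [← (e.arrowCongr (Equiv.refl (Fin q))).exists_congr_right]
    refine exists_congr fun c => ?_
    rw [← e.forall_congr_right]
    refine forall_congr' fun v => ?_
    rw [← e.exists_congr_right]
    refine exists_congr fun u => ?_
    rw [← e.forall_congr_right]
    simp [Equiv.arrowCongr]
  · simp only [neighbors, Colorable, CNCFColorable, IsCNCFColoring, if_true]
    rw [← (e.arrowCongr (Equiv.refl (Fin q))).exists_congr_right]
    refine exists_congr fun c => ?_
    rw [← e.forall_congr_right]
    refine forall_congr' fun v => ?_
    rw [← e.exists_congr_right]
    refine exists_congr fun u => ?_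
    rw [← e.forall_congr_right]
    simp [Equiv.arrowCongr]

/-! ### The program -/

/-- The program that initializes the variables `1` to `4`. -/
def setupProg (q : ℕ) : Prog :=
  .seq (assignProg 1 (load 0) 0) <| .seq (assignProg 2 (load 1) 0) <|
  .seq (assignProg 3 (var 1 * var 2) 0) (assignProg 4 (const (2 * q ^ 2)) 0)

/-- The program that decides the existence of a colouring. -/
def decideProg (closed : Bool) (q : ℕ) : Prog :=
  .seq (setupProg q) <| .seq orderProg <| .seq (tableProg closed q) (assignProg 0 (answerE q) 0)

/-- The values of the variables after `setupProg`. -/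
def setupEnv (n N Q : ℕ) : ℕ → ℕ :=
  Function.update (Function.update (Function.update (Function.update 0 1 n) 2 N) 3 (n * N)) 4 Q

theorem env_setupEnv (n N Q : ℕ) : Env n N Q (setupEnv n N Q) := by
  constructor <;> simp [setupEnv]

/-- A bound for the time of `setupProg`. -/
def setupTime (q L : ℕ) : ℕ :=
  assignTime (load 0) L + (assignTime (load 1) L +
    (assignTime (var 1 * var 2) L + assignTime (const (2 * q ^ 2)) L))

theorem runs_setupProg {n N q L : ℕ} {m : ℕ → ℕ} (hm : ∀ a, m a < 2 ^ L) (h0 : m 0 = n)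
    (h1 : m 1 = N) (hn : n ≤ L) (hN : N ≤ L) (hnN : n * N ≤ L) :
    Runs 0 (setupProg q) 0 m (setupEnv n N (2 * q ^ 2)) m (setupTime q L) := by
  have v0 : ∀ x, (0 : ℕ → ℕ) x ≤ L := fun x => Nat.zero_le L
  have v1 := update_le (x := 1) v0 hn
  have v2 := update_le (x := 2) v1 hN
  have v3 := update_le (x := 3) v2 hnN
  have r1 := runs_assignProg hm v0 1 (load 0) 0
  have r2 := runs_assignProg hm v1 2 (load 1) 0
  have r3 := runs_assignProg hm v2 3 (var 1 * var 2) 0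
  have r4 := runs_assignProg hm v3 4 (const (2 * q ^ 2)) 0
  rw [eval_load, eval_zero, h0] at r1
  rw [eval_load, eval_one, h1] at r2
  have e3 : (var 1 * var 2).eval m (Function.update (Function.update 0 1 n) 2 N) = n * N := by simp
  rw [e3] at r3
  exact r1.seq (r2.seq (r3.seq r4))

/-- A bound for the time of `decideProg`, divided by `(2 * q ^ 2) ^ T.width`. -/
def decideTime (closed : Bool) (q L : ℕ) : ℕ :=
  setupTime q L + (forTime L (storeTime (baseE + var 5) searchE L) +
    (forTime L (countdownTime countE L (2 * q ^ 2)
      (storeTime (addrE 5 (digitE 10)) (entryE closed q) L)) + assignTime (answerE q) L))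

theorem PolyBounded.forTime {T : ℕ → ℕ} (hT : PolyBounded T) :
    PolyBounded fun L => forTime L (T L) :=
  ((const 5).add .id).add (PolyBounded.id.mul (((const 9).add ((const 4).mul .id)).add hT))

theorem polyBounded_decideTime (closed : Bool) (q : ℕ) : PolyBounded (decideTime closed q) := by
  refine .add ?_ (.add ?_ (.add ?_ (polyBounded_assignTime _)))
  · exact (polyBounded_assignTime _).add ((polyBounded_assignTime _).add
      ((polyBounded_assignTime _).add (polyBounded_assignTime _)))
  · exact .forTime (polyBounded_storeTime _ _)
  · exact .forTime ((countE.polyBounded_time.add (.const 1)).add ((PolyBounded.const _).mul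
      (((PolyBounded.const 7).add ((PolyBounded.const 3).mul countE.polyBounded_bits)).add
        (polyBounded_storeTime _ _))))

/-- The number of rounds enters linearly, so `Q ^ width` can be taken out. The remaining factor `Q`,
due to bags of size `width + 1`, is absorbed into the constant. -/
theorem forTime_countdownTime_le (e : Expr) (L W Q T : ℕ) (hW : 0 < W) :
    forTime L (countdownTime e L (W * Q) T) ≤ W * forTime L (countdownTime e L Q T) := by
  unfold forTime countdownTime
  have h1 : 5 + L + L * (9 + 4 * L + (e.time L + 1)) ≤
      W * (5 + L + L * (9 + 4 * L + (e.time L + 1))) := Nat.le_mul_of_pos_left _ hW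
  calc _ = 5 + L + L * (9 + 4 * L + (e.time L + 1)) + W * (L * (Q * (7 + 3 * e.bits L + T))) := by
        ring
    _ ≤ _ := Nat.add_le_add_right h1 _
    _ = _ := by ring

/-- A bound for the variables and the binary lengths of the contents of the memory. -/
def sizeBound (q D : ℕ) : ℕ := (2 * q ^ 2 + 2) * ((D + 1) * (D + 1))

theorem exec_decideProg (closed : Bool) {q : ℕ} (hq : 0 < q) {n N : ℕ} (G : SimpleGraph (Fin n))
    (T : TreeDecomposition G (Fin N)) :
    (decideProg closed q).AnswersWithin (encode G T) (Colorable closed q G)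
      ((2 * q ^ 2) ^ T.width * decideTime closed q (sizeBound q (n + N))) := by
  classical
  set L := sizeBound q (n + N) with hLdef
  set Q := 2 * q ^ 2 with hQdef
  have hQ : 0 < Q := by positivity
  have hsq : (n + N + 1) * (n + N + 1) ≤ L := Nat.le_mul_of_pos_left _ (by omega)
  have hn : n ≤ L := by nlinarith
  have hN : N ≤ L := by nlinarith
  have hnN : n * N ≤ L := by nlinarith
  have hnN1 : n + N + 1 ≤ L := by nlinarith
  have hQL : Q ≤ L := by
    rw [hLdef, sizeBound, ← hQdef]
    exact (Nat.le_add_right Q 2).trans (Nat.le_mul_of_pos_right _ (by positivity))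
  -- This determines `sizeBound`: the modulus is a power of `q ^ 2 + 1` with exponent `(n + 1) * (n
  -- + 1)`, and a base up to `Q + 2` is at most `2 ^ (Q + 2)`.
  have hpow : ∀ c k, c ≤ Q + 2 → k ≤ (n + 1) * (n + 1) → c ^ k ≤ 2 ^ L := by
    intro c k hc hk
    calc c ^ k ≤ (2 ^ (Q + 2)) ^ k := Nat.pow_le_pow_left (hc.trans (Nat.lt_two_pow_self).le) k
      _ = 2 ^ ((Q + 2) * k) := by rw [pow_mul]
      _ ≤ 2 ^ L := Nat.pow_le_pow_right (by norm_num) (Nat.mul_le_mul_left _ (hk.trans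
          (Nat.mul_le_mul (by omega) (by omega))))
  have hM : modulus q n ≤ 2 ^ L := by
    unfold modulus bigBase
    rw [← pow_mul]
    exact hpow _ _ (by omega) le_rfl
  have hQn : Q ^ n ≤ 2 ^ L := hpow _ _ (by omega) (by nlinarith)
  have hmL : ∀ a, (encode G T).getD a 0 < 2 ^ L := fun a =>
    ((getD_encode_le T a).trans hnN1).trans_lt Nat.lt_two_pow_self
  have hv := env_setupEnv n N Q
  have hvL : ∀ x, setupEnv n N Q x ≤ L :=
    update_le (update_le (update_le (update_le (fun _ => Nat.zero_le L) hn) hN) hnN) hQL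
  have r1 := runs_setupProg (q := q) hmL (getD_encode_zero T) (getD_encode_one T) hn hN hnN
  obtain ⟨m1, o, r, hp1, hm1, ho, hr, r2⟩ := runs_orderProg hv hvL (holds_encode T) hmL
    (exists_canEliminate T)
  have hu5 : Function.update (setupEnv n N Q) 5 0 = setupEnv n N Q :=
    Function.update_eq_self_iff.2 (by simp [setupEnv])
  -- The vertices `o j` and `o k` share the bag of `r i`, and `o k` is alive in step `j`; by the
  -- choice of `r j` its bag contains `o k`.
  have hb : ∀ i j k, i < j → j < k → k < n → bagRel T (r i) (o j) → bagRel T (r i) (o k) →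
      bagRel T (r j) (o k) := fun i j k hij hjk hk h1 h2 =>
    hr j (by omega) (r i) (hp1.own_lt i (by omega)) h1 (o k) (hp1.ord_lt k hk)
      (fun l hl => ho k hk l (by omega)) h2
  have hg : ∀ i j, i < j → j < n → adjRel G (o i) (o j) → bagRel T (r i) (o j) :=
    fun i j hij hj h => by
      obtain ⟨w, hw, h1, h2⟩ := exists_bagRel_of_adjRel T h
      exact hr i (by omega) w hw h1 (o j) (hp1.ord_lt j hj) (fun l hl => ho j hj l (by omega)) h2
  rw [hu5] at r2
  obtain ⟨m2, hp2, hm2, htab, r3⟩ := runs_tableProg (W := Q ^ T.width * Q) closed hq hv hvL hp1 hm1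
    hM hQn (fun i _ => prod_radix_le T hQ ho (r i) r i rfl) hg hb
  rw [hu5] at r3
  have r4 := runs_assignProg hm2 hvL 0 (answerE q) 0
  obtain ⟨c, t, he, -, hc⟩ := (r1.seq (r2.seq (r3.seq r4))) 0
  have hinit : initState (encode G T) = State.mk' 0 0 fun a => (encode G T).getD a 0 := by
    simp [initState, State.mk']
  refine ⟨c, _, by rw [hinit]; exact he, ?_, hc.trans ?_⟩
  · have h0 := State.mk'_even (Function.update (setupEnv n N Q) 0
      ((answerE q).eval m2 (setupEnv n N Q))) t m2 0
    rw [mul_zero] at h0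
    rw [h0, Function.update_self, eval_answerE hv hp2]
    have hinj : Function.Injective fun i : Fin n => (⟨o i, hp1.ord_lt i i.2⟩ : Fin n) := by
      intro i j hij
      have hij : o i = o j := congrArg Fin.val hij
      rcases lt_trichotomy i j with h | h | h
      · exact absurd hij (ho j j.2 i h)
      · exact h
      · exact absurd hij.symm (ho i i.2 j h)
    have hcol := colorable_iff closed q G
      (Equiv.ofBijective _ (Finite.injective_iff_bijective.1 hinj))
      (g := fun i j : Fin n => adjRel G (o i) (o j))
      (fun x y => by simp [adjRel, hp1.ord_lt])
    rw [← sum_weight_ne_zero_iff closed hq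
      (fun i j ⟨h1, h2, h⟩ => ⟨h2, h1, h.symm⟩) (fun i ⟨h1, h2, h⟩ => h.ne rfl)] at hcol
    have hsum := prod_factor_eq_sum Q (fun a => (weight closed q n a : ZMod (modulus q n)))
      (fun a c => ((effect q (bigBase q n) a c * effect q (bigBase q n) c a : ℕ) :
        ZMod (modulus q n))) hg hb 0
    rw [← hsum] at hcol
    have hprod : (∏ h ∈ Finset.range n, ((if ∀ k < n, h < k → ¬ bagRel T (r h) (o k) then
        m2 (addr n N Q (fun h j => bagRel T (r h) (o j)) h 0) else 1 : ℕ) :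
          ZMod (modulus q n))) =
        ∏ h ∈ Finset.range n, if ∀ k < n, h < k → ¬ bagRel T (r h) (o k) then
          stepFactor closed q n (adjRel G) (bagRel T) o r h 0 else 1 := by
      refine Finset.prod_congr rfl fun h hh => ?_
      split_ifs
      · exact htab h (Finset.mem_range.1 hh) 0 fun _ => hQ
      · simp
    rw [Ne, ← stepFactor, ← hprod, ← Nat.cast_prod, ZMod.natCast_eq_zero_iff,
      Nat.dvd_iff_mod_eq_zero] at hcol
    by_cases h : Colorable closed q G
    · rw [if_pos h, if_neg (hcol.2 h)]
    · rw [if_neg h, if_pos (by by_contra h'; exact h (hcol.1 h'))]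
  · have hpos : 0 < Q ^ T.width := by positivity
    have h3 := forTime_countdownTime_le countE L (Q ^ T.width) Q
      (storeTime (addrE 5 (digitE 10)) (entryE closed q) L) hpos
    unfold decideTime
    rw [mul_add, mul_add, mul_add]
    exact add_le_add (Nat.le_mul_of_pos_left _ hpos) <|
      add_le_add (Nat.le_mul_of_pos_left _ hpos) <|
      add_le_add h3 (Nat.le_mul_of_pos_left _ hpos)

theorem exists_program (closed : Bool) {q : ℕ} (hq : 0 < q) :
    ∃ (P : Prog) (C k : ℕ), ∀ (n N : ℕ) (G : SimpleGraph (Fin n))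
      (T : TreeDecomposition G (Fin N)),
        P.AnswersWithin (encode G T) (Colorable closed q G)
          (C * (2 * q ^ 2) ^ T.width * (n + N) ^ k) := by
  have hsize : PolyBounded (sizeBound q) :=
    (PolyBounded.const _).mul ((PolyBounded.id.add (.const 1)).mul (PolyBounded.id.add (.const 1)))
  obtain ⟨C, k, h⟩ := (polyBounded_decideTime closed q).comp hsize
  refine ⟨decideProg closed q, C * 2 ^ k, k, fun n N G T => ?_⟩
  obtain ⟨c, s, he, hs, hc⟩ := exec_decideProg closed hq G T
  refine ⟨c, s, he, hs, hc.trans ?_⟩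
  -- A tree has a node. So `n + N + 1 ≤ 2 * (n + N)`, even for the graph without vertices, and the
  -- power of `n + N` does not degenerate.
  have hN : 0 < N := (T.isTree.connected.nonempty.some).pos
  calc (2 * q ^ 2) ^ T.width * decideTime closed q (sizeBound q (n + N))
      ≤ (2 * q ^ 2) ^ T.width * (C * (n + N + 1) ^ k) := Nat.mul_le_mul_left _ (h _)
    _ ≤ (2 * q ^ 2) ^ T.width * (C * (2 * (n + N)) ^ k) :=
        Nat.mul_le_mul_left _ (Nat.mul_le_mul_left _ (Nat.pow_le_pow_left (by omega) k))
    _ = C * 2 ^ k * (2 * q ^ 2) ^ T.width * (n + N) ^ k := by rw [mul_pow 2 (n + N) k]; ring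

end ConflictFree

theorem theorem1 (q : ℕ) (hq : 1 ≤ q) :
    (∃ (P : Prog) (C k : ℕ), ∀ (n N : ℕ) (G : SimpleGraph (Fin n))
      (T : TreeDecomposition G (Fin N)),
        P.AnswersWithin (encode G T) (ONCFColorable q G)
          (C * (2 * q ^ 2) ^ T.width * (n + N) ^ k)) ∧
    (∃ (P : Prog) (C k : ℕ), ∀ (n N : ℕ) (G : SimpleGraph (Fin n))
      (T : TreeDecomposition G (Fin N)),
        P.AnswersWithin (encode G T) (CNCFColorable q G)
          (C * (2 * q ^ 2) ^ T.width * (n + N) ^ k)) :=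
  ⟨exists_program false hq, exists_program true hq⟩
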